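/- Let $N>2$, let $p_1,\dots,p_N>1$, put $p_i'=p_i/(p_i-1)$, and let $\bar p$, given by $\frac1{\bar p}=\frac1N\sum_{i=1}^N\frac1{p_i}$, satisfy $\bar p<N$. Put $\bar p^*=\frac{N\bar p}{N-\bar p}$ and $p_\infty=\max\{\bar p^*,\max_i p_i\}$. Let $\Omega\subset\mathbb R^N$ be a bounded open set (in particular, a bounded domain with Lipschitz boundary), and let $W_0^{1,\vec p}(\Omega)$ be the closure of $C_0^\infty(\Omega)$ in the norm $\sum_{i=1}^N\|\partial_{x_i}u\|_{L^{p_i}(\Omega)}$ (which on $C_0^\infty(\Omega)$ is equivalent to $\|u\|_{L^1(\Omega)}+\sum_{i=1}^N\|\partial_{x_i}u\|_{L^{p_i}(\Omega)}$). For every $i=1,\dots,N$ assume: * (H1) $\mathcal A_i:\Omega\times\mathbb R^N\to\mathbb R$ is a Carathéodory function and there are constants $0<\alpha\le\beta_i$ such that, for a.e. $x\in\Omega$ and all $\xi,\eta\in\mathbb R^N$, $|\mathcal A_i(x,\xi)|\le\beta_i|\xi_i|^{p_i-1}$, $\ \alpha|\xi_i|^{p_i}\le\mathcal A_i(x,\xi)\,\xi_i$,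 and $(\mathcal A_i(x,\xi)-\mathcal A_i(x,\eta))(\xi_i-\eta_i)>0$ whenever $\xi_i\ne\eta_i$. * (H2) $\mathcal B_i:\Omega\times\mathbb R\to\mathbb R$ is a Carathéodory function with $|\mathcal B_i(x,s)|\le b_i(x)|s|^{\bar p/p_i'}$ for a.e. $x\in\Omega$ and all $s\in\mathbb R$, where $b_i:\Omega\to[0,+\infty)$ is measurable and belongs to the Marcinkiewicz space $L^{Np_i'/\bar p,\infty}(\Omega)$, i.e. $\sup_{t>0}t^{Np_i'/\bar p}\,|\{x\in\Omega: b_i(x)>t\}|<\infty$. * (H3) Either $\mathcal G\equiv0$, or $\mathcal G:\Omega\times\mathbb R\to\mathbb R$ is a Carathéodory function such that, for some constants $\tilde\mu\ge0$ and $1\le\gamma<p_\infty-1$, $|\mathcal G(x,s)|\le\tilde\mu|s|^\gamma$ and $\mathcal G(x,s)\,s\ge0$ for a.e. $x\in\Omega$ and all $s\in\mathbb R$. * (H4) $\mathcal F\in(W_0^{1,\vec p}(\Omega))^*$. A weak solution of the Dirichlet problem $$-\sum_{i=1}^N\partial_{x_i}\left[\mathcal A_i(x,\nabla u)+\mathcal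 B_i(x,u)\right]+\mathcal G(x,u)=\mathcal F\ \text{ in }\Omega,\qquad u=0\ \text{ on }\partial\Omega,$$ is a function $u\in W_0^{1,\vec p}(\Omega)$ such that $$\int_\Omega\Big[\sum_{i=1}^N\left[\mathcal A_i(x,\nabla u)+\mathcal B_i(x,u)\right]\partial_{x_i}\varphi+\mathcal G(x,u)\,\varphi\Big]dx=\langle\mathcal F,\varphi\rangle\qquad\text{for all }\varphi\in C_0^\infty(\Omega).$$ Then, if $\mathcal F\equiv0$, every weak solution $u$ satisfies $u=0$ a.e. in $\Omega$. -/

import Mathlib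

open MeasureTheory TopologicalSpace Distributions

namespace Anisotropic

/-! Points of `ℝ^N` and gradients are vectors `Fin N → ℝ`; `volume` is Lebesgue measure.
Functions on `Ω` are represented by functions on `ℝ^N`, of which only the values on `Ω` matter. -/

/-! ### Exponents -/

/-- The harmonic mean `p̄`, defined by `1 / p̄ = (1 / N) ∑ i, 1 / p i`. -/
noncomputable def harmonicMean {N : ℕ} (p : Fin N → ℝ) : ℝ :=
  ((1 / (N : ℝ)) * ∑ i, 1 / p i)⁻¹

/-- The Sobolev exponent `p̄* = N p̄ / (N - p̄)`, used for `p̄ < N`. -/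
noncomputable def sobolevExponent {N : ℕ} (p : Fin N → ℝ) : ℝ :=
  N * harmonicMean p / (N - harmonicMean p)

/-- `p_∞ = max (p̄*) (max_i p i)`. -/
noncomputable def pInfty {N : ℕ} (p : Fin N → ℝ) : ℝ :=
  max (sobolevExponent p) (⨆ i, p i)

/-- The conjugate exponent `q' = q / (q - 1)`, used for `q > 1`. -/
noncomputable def conj (q : ℝ) : ℝ := q / (q - 1)

instance factOneLeOfReal {q : ℝ} [h : Fact (1 < q)] : Fact (1 ≤ ENNReal.ofReal q) :=
  ⟨by simpa using ENNReal.ofReal_le_ofReal h.out.le⟩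

/-! ### Function spaces -/

/-- The Marcinkiewicz space `L^{q,∞}(Ω)`: measurable functions `f` on `Ω` such that
`sup_{t > 0} t ^ q |{x ∈ Ω : |f x| > t}|` is finite. -/
def MemMarcinkiewicz {N : ℕ} (Ω : Set (Fin N → ℝ)) (q : ℝ) (f : (Fin N → ℝ) → ℝ) : Prop :=
  AEMeasurable f (volume.restrict Ω) ∧
    ∃ C : ℝ, ∀ t : ℝ, 0 < t →
      ENNReal.ofReal (t ^ q) * volume {x ∈ Ω | t < |f x|} ≤ ENNReal.ofReal C

/-- A Carathéodory function `f : Ω × S → ℝ`: measurable in `x ∈ Ω` for every `s`, and continuous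
in `s` for almost every `x ∈ Ω`. -/
structure IsCaratheodory {N : ℕ} {S : Type*} [TopologicalSpace S] (Ω : Set (Fin N → ℝ))
    (f : (Fin N → ℝ) → S → ℝ) : Prop where
  measurable : ∀ s, AEMeasurable (fun x => f x s) (volume.restrict Ω)
  continuous : ∀ᵐ x ∂volume.restrict Ω, Continuous (f x)

/-- The classical partial derivative in the `i`-th coordinate direction. -/
noncomputable def partialDeriv {N : ℕ} (i : Fin N) (φ : (Fin N → ℝ) → ℝ) (x : Fin N → ℝ) : ℝ :=
  fderiv ℝ φ x (Pi.single i 1)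

section Sobolev

variable {N : ℕ} (p : Fin N → ℝ) (Ω : Opens (Fin N → ℝ))

/-- The space `L¹(Ω) × ∏ i, L^{p i}(Ω)`, which contains the pairs `(u, ∇u)`. -/
abbrev PairSpace : Type :=
  Lp ℝ 1 (volume.restrict (Ω : Set (Fin N → ℝ))) ×
    ((i : Fin N) → Lp ℝ (ENNReal.ofReal (p i)) (volume.restrict (Ω : Set (Fin N → ℝ))))

variable {Ω}

theorem memLp_testFunction (φ : 𝓓(Ω, ℝ)) (q : ENNReal) :
    MemLp φ q (volume.restrict (Ω : Set (Fin N → ℝ))) :=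
  (φ.continuous.memLp_of_hasCompactSupport φ.hasCompactSupport).restrict _

theorem memLp_partialDeriv (φ : 𝓓(Ω, ℝ)) (i : Fin N) (q : ENNReal) :
    MemLp (partialDeriv i φ) q (volume.restrict (Ω : Set (Fin N → ℝ))) := by
  have hc : Continuous (partialDeriv i φ) :=
    (φ.contDiff.continuous_fderiv (by simp)).clm_apply continuous_const
  have hs : HasCompactSupport (partialDeriv i φ) :=
    φ.hasCompactSupport.fderiv_apply (𝕜 := ℝ) (Pi.single i 1)
  exact (hc.memLp_of_hasCompactSupport hs).restrict _

theorem partialDeriv_add (φ ψ : 𝓓(Ω, ℝ)) (i : Fin N) :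
    partialDeriv i (⇑(φ + ψ)) = partialDeriv i φ + partialDeriv i ψ := by
  funext x
  have h1 : DifferentiableAt ℝ φ x := (φ.contDiff.differentiable (by simp)) x
  have h2 : DifferentiableAt ℝ ψ x := (ψ.contDiff.differentiable (by simp)) x
  simp [partialDeriv, FunLike.coe_add, fderiv_add h1 h2]

theorem partialDeriv_smul (c : ℝ) (φ : 𝓓(Ω, ℝ)) (i : Fin N) :
    partialDeriv i (⇑(c • φ)) = c • partialDeriv i φ := by
  funext x
  have h1 : DifferentiableAt ℝ φ x := (φ.contDiff.differentiable (by simp)) x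
  simp [partialDeriv, FunLike.coe_smul, fderiv_const_smul h1 c]

/-- The linear map `φ ↦ (φ, ∇φ)` on `C_c^∞(Ω)`. -/
noncomputable def testPair : 𝓓(Ω, ℝ) →ₗ[ℝ] PairSpace p Ω where
  toFun φ := ((memLp_testFunction φ 1).toLp φ,
    fun i => (memLp_partialDeriv φ i (ENNReal.ofReal (p i))).toLp (partialDeriv i φ))
  map_add' φ ψ := by
    refine Prod.ext ?_ (funext fun i => ?_)
    · exact MemLp.toLp_add (memLp_testFunction φ 1) (memLp_testFunction ψ 1)
    · refine Eq.trans ?_ (MemLp.toLp_add (memLp_partialDeriv φ i _) (memLp_partialDeriv ψ i _))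
      simp only [partialDeriv_add]
  map_smul' c φ := by
    refine Prod.ext ?_ (funext fun i => ?_)
    · exact MemLp.toLp_const_smul c (memLp_testFunction φ 1)
    · refine Eq.trans ?_ (MemLp.toLp_const_smul c (memLp_partialDeriv φ i _))
      simp only [partialDeriv_smul]

variable (Ω) [∀ i, Fact (1 < p i)]

/-- The anisotropic Sobolev space `W_0^{1,p}(Ω)`: the closure of `C_c^∞(Ω)` in the norm of
`u ∈ L¹(Ω)`, `∂_i u ∈ L^{p i}(Ω)`. An element is stored as the pair `(u, ∇u)` in
`L¹(Ω) × ∏ i, L^{p i}(Ω)`, where `∇u` is the weak gradient of `u`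
(see `integral_w0Fun_mul_partialDeriv`).
On a bounded set this norm is equivalent, by the Poincaré inequality, to `∑ i, ‖∂_i u‖_{L^{p i}}`;
so this is also the closure in the latter norm, with the same dual space. -/
noncomputable def AnisotropicW0 : Submodule ℝ (PairSpace p Ω) :=
  (LinearMap.range (testPair (Ω := Ω) p)).topologicalClosure

variable {p Ω}

/-- The function underlying an element of `W_0^{1,p}(Ω)`. -/
noncomputable def w0Fun (u : AnisotropicW0 p Ω) : (Fin N → ℝ) → ℝ :=
  (u : PairSpace p Ω).1

/-- The weak gradient of an element of `W_0^{1,p}(Ω)`. -/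
noncomputable def w0Grad (u : AnisotropicW0 p Ω) (x : Fin N → ℝ) : Fin N → ℝ :=
  fun i => (u : PairSpace p Ω).2 i x

/-- The inclusion of `C_c^∞(Ω)` in `W_0^{1,p}(Ω)`. -/
noncomputable def w0OfTest (φ : 𝓓(Ω, ℝ)) : AnisotropicW0 p Ω :=
  ⟨testPair p φ, Submodule.le_topologicalClosure _ ⟨φ, rfl⟩⟩

/-- `w0Grad u` is the weak gradient of `w0Fun u` in `Ω`. -/
theorem integral_w0Fun_mul_partialDeriv (u : AnisotropicW0 p Ω) (i : Fin N) (ψ : 𝓓(Ω, ℝ)) :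
    ∫ x in (Ω : Set (Fin N → ℝ)), w0Fun u x * partialDeriv i ψ x
      = - ∫ x in (Ω : Set (Fin N → ℝ)), w0Grad u x i * ψ x := by
  let m := volume.restrict (Ω : Set (Fin N → ℝ))
  let q := ENNReal.ofReal (p i)
  have key : ∀ (r : ENNReal) [Fact (1 ≤ r)] (g : (Fin N → ℝ) → ℝ),
      (∀ s, MemLp g s m) → Continuous fun f : Lp ℝ r m => ∫ x, f x * g x ∂m := by
    intro r hr g hg
    have : r.HolderConjugate (1 - r⁻¹)⁻¹ := ENNReal.HolderConjugate.inv_one_sub_inv' hr.out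
    have : Fact (1 ≤ (1 - r⁻¹)⁻¹) := ⟨by simp⟩
    have h := (((ContinuousLinearMap.mul ℝ ℝ).lpPairing m r (1 - r⁻¹)⁻¹).flip
      ((hg (1 - r⁻¹)⁻¹).toLp g)).continuous
    refine h.congr fun f => ?_
    rw [ContinuousLinearMap.flip_apply, ContinuousLinearMap.lpPairing_eq_integral]
    refine integral_congr_ae ?_
    filter_upwards [(hg (1 - r⁻¹)⁻¹).coeFn_toLp] with x hx
    simp [hx]
  have h1 := key 1 _ fun s => memLp_partialDeriv ψ i s
  have h2 := key q _ fun s => memLp_testFunction ψ s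
  have hcl : IsClosed {v : PairSpace p Ω |
      ∫ x, v.1 x * partialDeriv i ψ x ∂m = - ∫ x, v.2 i x * ψ x ∂m} :=
    isClosed_eq (h1.comp continuous_fst)
      (h2.comp ((continuous_apply i).comp continuous_snd)).neg
  refine closure_minimal ?_ hcl u.2
  rintro _ ⟨φ, rfl⟩
  have e1 : ∫ x, ((testPair p φ).1 : (Fin N → ℝ) → ℝ) x * partialDeriv i ψ x ∂m
      = ∫ x, φ x * partialDeriv i ψ x ∂m := by
    refine integral_congr_ae ?_
    filter_upwards [(memLp_testFunction φ 1).coeFn_toLp] with x hx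
    exact congrArg (· * _) hx
  have e2 : ∫ x, ((testPair p φ).2 i : (Fin N → ℝ) → ℝ) x * ψ x ∂m
      = ∫ x, partialDeriv i φ x * ψ x ∂m := by
    refine integral_congr_ae ?_
    filter_upwards [(memLp_partialDeriv φ i q).coeFn_toLp] with x hx
    exact congrArg (· * _) hx
  have hφ : Continuous (partialDeriv i φ) :=
    (φ.contDiff.continuous_fderiv (by simp)).clm_apply continuous_const
  have hψ : Continuous (partialDeriv i ψ) :=
    (ψ.contDiff.continuous_fderiv (by simp)).clm_apply continuous_const
  have z1 : ∀ x ∉ (Ω : Set (Fin N → ℝ)), φ x * partialDeriv i ψ x = 0 := fun x hx => by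
    rw [image_eq_zero_of_notMem_tsupport fun h => hx (φ.tsupport_subset h), zero_mul]
  have z2 : ∀ x ∉ (Ω : Set (Fin N → ℝ)), partialDeriv i φ x * ψ x = 0 := fun x hx => by
    rw [image_eq_zero_of_notMem_tsupport fun h => hx (ψ.tsupport_subset h), mul_zero]
  change _ = - _
  rw [e1, e2, setIntegral_eq_integral_of_forall_compl_eq_zero z1,
    setIntegral_eq_integral_of_forall_compl_eq_zero z2]
  exact integral_mul_fderiv_eq_neg_fderiv_mul_of_integrable
    ((hφ.mul ψ.continuous).integrable_of_hasCompactSupport ψ.hasCompactSupport.mul_left)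
    ((φ.continuous.mul hψ).integrable_of_hasCompactSupport φ.hasCompactSupport.mul_right)
    ((φ.continuous.mul ψ.continuous).integrable_of_hasCompactSupport ψ.hasCompactSupport.mul_left)
    (fun x _ => (φ.contDiff.differentiable (by simp)) x)
    (fun x _ => (ψ.contDiff.differentiable (by simp)) x)

end Sobolev

/-! ### The Dirichlet problem
`-∑ i, ∂_i [A_i(x, ∇u) + B_i(x, u)] + G(x, u) = F` in `Ω`, `u = 0` on `∂Ω`. -/

section Problem

variable {N : ℕ} (p : Fin N → ℝ) (Ω : Opens (Fin N → ℝ))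

/-- Structure of the principal part, with constants `α` and `β i`. -/
structure PrincipalPart (α : ℝ) (β : Fin N → ℝ)
    (A : Fin N → (Fin N → ℝ) → (Fin N → ℝ) → ℝ) : Prop where
  alpha_pos : 0 < α
  alpha_le : ∀ i, α ≤ β i
  caratheodory : ∀ i, IsCaratheodory (Ω : Set (Fin N → ℝ)) (A i)
  growth : ∀ i, ∀ᵐ x ∂volume.restrict (Ω : Set (Fin N → ℝ)), ∀ ξ : Fin N → ℝ,
    |A i x ξ| ≤ β i * |ξ i| ^ (p i - 1)
  coercive : ∀ i, ∀ᵐ x ∂volume.restrict (Ω : Set (Fin N → ℝ)), ∀ ξ : Fin N → ℝ,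
    α * |ξ i| ^ p i ≤ A i x ξ * ξ i
  monotone : ∀ i, ∀ᵐ x ∂volume.restrict (Ω : Set (Fin N → ℝ)), ∀ ξ η : Fin N → ℝ,
    ξ i ≠ η i → 0 < (A i x ξ - A i x η) * (ξ i - η i)

/-- Structure of the first order term, with coefficients `b i`. -/
structure ConvectionTerm (b : Fin N → (Fin N → ℝ) → ℝ)
    (B : Fin N → (Fin N → ℝ) → ℝ → ℝ) : Prop where
  caratheodory : ∀ i, IsCaratheodory (Ω : Set (Fin N → ℝ)) (B i)
  nonneg : ∀ i, ∀ x ∈ Ω, 0 ≤ b i x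
  marcinkiewicz : ∀ i,
    MemMarcinkiewicz (Ω : Set (Fin N → ℝ)) (N * conj (p i) / harmonicMean p) (b i)
  growth : ∀ i, ∀ᵐ x ∂volume.restrict (Ω : Set (Fin N → ℝ)), ∀ s : ℝ,
    |B i x s| ≤ b i x * |s| ^ (harmonicMean p / conj (p i))

/-- Structure of the zero order term, with constants `μ` and `γ`. -/
structure ZeroOrderTerm (μ γ : ℝ) (G : (Fin N → ℝ) → ℝ → ℝ) : Prop where
  caratheodory : IsCaratheodory (Ω : Set (Fin N → ℝ)) G
  mu_nonneg : 0 ≤ μ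
  one_le_gamma : 1 ≤ γ
  gamma_lt : γ < pInfty p - 1
  growth : ∀ᵐ x ∂volume.restrict (Ω : Set (Fin N → ℝ)), ∀ s : ℝ, |G x s| ≤ μ * |s| ^ γ
  sign : ∀ᵐ x ∂volume.restrict (Ω : Set (Fin N → ℝ)), ∀ s : ℝ, 0 ≤ G x s * s

variable {p Ω} [∀ i, Fact (1 < p i)]

/-- `u ∈ W_0^{1,p}(Ω)` is a weak solution of the Dirichlet problem with datum `F` in the dual
of `W_0^{1,p}(Ω)`. -/
def IsWeakSolution (A : Fin N → (Fin N → ℝ) → (Fin N → ℝ) → ℝ)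
    (B : Fin N → (Fin N → ℝ) → ℝ → ℝ) (G : (Fin N → ℝ) → ℝ → ℝ)
    (F : StrongDual ℝ (AnisotropicW0 p Ω)) (u : AnisotropicW0 p Ω) : Prop :=
  ∀ φ : 𝓓(Ω, ℝ),
    ∫ x in (Ω : Set (Fin N → ℝ)),
      ((∑ i, (A i x (w0Grad u x) + B i x (w0Fun u x)) * partialDeriv i φ x)
        + G x (w0Fun u x) * φ x) = F (w0OfTest φ)

end Problem

end Anisotropic

/-! Write P for the harmonic mean of the exponents. The equation is tested with a smooth truncation
of `u / ε` whose derivative lives on the layer ε ≤ |u| < 2ε. The zero order term has a good sign and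
is dropped; coercivity and Young's inequality leave, for each j, an energy of ∂_j u on the layer of
size at most ε^P η(ε), where η(ε) is a combination of the integrals of b_i^{p_i'} over the layer
(`exists_layerEnergy_le`). Since b_i^{p_i'} is integrable and every point leaves the layers as ε →
0, η(ε) → 0. No smallness of b_i is needed.

Some direction j has p_j ≤ P. Hölder's inequality turns the energy bound into an L¹ bound o(ε) for
∂_j u on the layer, and the one-directional Poincaré inequality for the truncation gives ε |{|u| ≥
2ε}| ≤ o(ε). So |{|u| ≥ 2ε}| → 0 as ε → 0; but this quantity increases as ε decreases, so it
vanishes for every ε (`ae_eq_zero_of_layerEnergy_le`).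

It must also be justified that functions of `u` are admissible tests (`weak_equation_comp`), which
requires B_i(x, u) in L^{p_i'} and G(x, u) in L¹. The first is critical: b_i^{p_i'} is only in weak
L^{N/P}, so membership of `u` in L^{P*} does not suffice, and the Lorentz refinement ∑ 2^{kP} |{|u|
≥ 2^k}|^{1 - P/N} < ∞ is proved instead (`summable_superlevel_rpow`). It comes from truncation at
dyadic heights and the Gagliardo–Nirenberg inequality, with weights on the coordinate directions
chosen to balance the different p_i. -/

namespace Anisotropic

open Filter Set
open scoped ENNReal NNReal Topology ContDiff

/-! ### A smooth cutoff -/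

/-- A smooth odd increasing function, zero on `[-1, 1]` and equal to `±1` where `2 ≤ |x|`. -/
noncomputable def ramp (x : ℝ) : ℝ :=
  Real.smoothTransition (x - 1) - Real.smoothTransition (-x - 1)

theorem ramp_contDiff : ContDiff ℝ ∞ ramp :=
  (Real.smoothTransition.contDiff.comp (by fun_prop)).sub
    (Real.smoothTransition.contDiff.comp (by fun_prop))

theorem ramp_monotone : Monotone ramp := fun x y h =>
  sub_le_sub (Real.smoothTransition.monotone (by linarith))
    (Real.smoothTransition.monotone (by linarith))

theorem ramp_eq_zero {x : ℝ} (h : |x| ≤ 1) : ramp x = 0 := by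
  obtain ⟨h1, h2⟩ := abs_le.1 h
  rw [ramp, Real.smoothTransition.zero_of_nonpos (by linarith),
    Real.smoothTransition.zero_of_nonpos (by linarith), sub_zero]

theorem ramp_eq_one {x : ℝ} (h : 2 ≤ x) : ramp x = 1 := by
  rw [ramp, Real.smoothTransition.one_of_one_le (by linarith),
    Real.smoothTransition.zero_of_nonpos (by linarith), sub_zero]

theorem ramp_eq_neg_one {x : ℝ} (h : x ≤ -2) : ramp x = -1 := by
  rw [ramp, Real.smoothTransition.one_of_one_le (x := -x - 1) (by linarith),
    Real.smoothTransition.zero_of_nonpos (by linarith), zero_sub]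

theorem ramp_zero : ramp 0 = 0 := ramp_eq_zero (by simp)

theorem abs_ramp_le_one (x : ℝ) : |ramp x| ≤ 1 := by
  have h1 := Real.smoothTransition.nonneg (x - 1)
  have h2 := Real.smoothTransition.nonneg (-x - 1)
  have h3 := Real.smoothTransition.le_one (x - 1)
  have h4 := Real.smoothTransition.le_one (-x - 1)
  rw [abs_le]
  constructor <;> · unfold ramp; linarith

theorem abs_ramp_eq_one {x : ℝ} (h : 2 ≤ |x|) : |ramp x| = 1 := by
  rcases le_abs.1 h with h | h
  · rw [ramp_eq_one h, abs_one]
  · rw [ramp_eq_neg_one (by linarith), abs_neg, abs_one]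

/-- The sign condition on the zero order term survives truncation, because `ramp` has the sign of
its argument. -/
theorem mul_ramp_nonneg {x y : ℝ} (ε : ℝ) (hε : 0 < ε) (h : 0 ≤ y * x) :
    0 ≤ y * ramp (x / ε) := by
  rcases lt_trichotomy x 0 with hx | rfl | hx
  · have h1 : ramp (x / ε) ≤ 0 := by
      simpa [ramp_zero] using ramp_monotone (div_nonpos_of_nonpos_of_nonneg hx.le hε.le)
    have h2 : y ≤ 0 := by
      by_contra! hy
      nlinarith
    exact mul_nonneg_of_nonpos_of_nonpos h2 h1
  · simp [ramp_zero]
  · have h1 : 0 ≤ ramp (x / ε) := by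
      simpa [ramp_zero] using ramp_monotone (div_nonneg hx.le hε.le)
    exact mul_nonneg (nonneg_of_mul_nonneg_left h hx) h1

theorem continuous_deriv_ramp : Continuous (deriv ramp) :=
  ramp_contDiff.continuous_deriv (by simp)

theorem deriv_ramp_nonneg (x : ℝ) : 0 ≤ deriv ramp x := ramp_monotone.deriv_nonneg

/-- The endpoints 1 and 2 are reached by continuity of the derivative: its zero set is closed and
contains the open intervals on which `ramp` is constant. -/
theorem deriv_ramp_eq_zero {x : ℝ} (h : |x| ≤ 1 ∨ 2 ≤ |x|) : deriv ramp x = 0 := by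
  have hcl : IsClosed {x : ℝ | deriv ramp x = 0} :=
    isClosed_eq continuous_deriv_ramp continuous_const
  have key : ∀ (s : Set ℝ) (a : ℝ), IsOpen s → (∀ y ∈ s, ramp y = a) →
      closure s ⊆ {x : ℝ | deriv ramp x = 0} := by
    intro s a hs ha
    refine closure_minimal (fun y hy => ?_) hcl
    have : ramp =ᶠ[𝓝 y] fun _ => a := by
      filter_upwards [hs.mem_nhds hy] with z hz using ha z hz
    simp [this.deriv_eq]
  rcases h with h | h
  · refine key (Ioo (-1) 1) 0 isOpen_Ioo
      (fun y hy => ramp_eq_zero (abs_le.2 ⟨hy.1.le, hy.2.le⟩)) ?_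
    rw [closure_Ioo (by norm_num)]
    exact abs_le.1 h
  · rcases le_abs.1 h with h | h
    · refine key (Ioi 2) 1 isOpen_Ioi (fun y hy => ramp_eq_one (le_of_lt hy)) ?_
      rw [closure_Ioi]
      exact h
    · refine key (Iio (-2)) (-1) isOpen_Iio (fun y hy => ramp_eq_neg_one (le_of_lt hy)) ?_
      rw [closure_Iio]
      exact le_neg.1 h

theorem exists_deriv_ramp_le : ∃ L : ℝ, 1 ≤ L ∧ ∀ x, deriv ramp x ≤ L := by
  obtain ⟨L, hL⟩ := (isCompact_Icc (a := (-2 : ℝ)) (b := 2)).bddAbove_image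
    continuous_deriv_ramp.continuousOn
  refine ⟨max L 1, le_max_right _ _, fun x => ?_⟩
  by_cases hx : x ∈ Icc (-2 : ℝ) 2
  · exact (hL ⟨x, hx, rfl⟩).trans (le_max_left _ _)
  · rw [deriv_ramp_eq_zero]
    · positivity
    · right
      by_contra! h
      exact hx (abs_le.1 h.le)

theorem deriv_ramp_div (ε x : ℝ) :
    deriv (fun y => ramp (y / ε)) x = deriv ramp (x / ε) / ε := by
  have h : HasDerivAt (fun y => ramp (y / ε)) (deriv ramp (x / ε) * (1 / ε)) x :=
    HasDerivAt.comp x (h₂ := ramp)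
      ((ramp_contDiff.differentiable (by simp)) (x / ε)).hasDerivAt
      ((hasDerivAt_id x).div_const ε)
  rw [h.deriv, mul_one_div]

theorem deriv_ramp_div_sq (ε x : ℝ) :
    deriv (fun y => ramp (y / ε) ^ 2) x = 2 * ramp (x / ε) * (deriv ramp (x / ε) / ε) := by
  have h1 : DifferentiableAt ℝ (fun y => ramp (y / ε)) x :=
    (ramp_contDiff.comp (contDiff_id.div_const ε)).differentiable (by simp) x
  have h := h1.hasDerivAt.pow 2
  rw [deriv_ramp_div] at h
  refine h.deriv.trans ?_
  simp

theorem contDiff_ramp_div (ε : ℝ) : ContDiff ℝ ∞ fun y => ramp (y / ε) :=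
  ramp_contDiff.comp (contDiff_id.div_const ε)

/-! ### Test functions -/

section Test

variable {N : ℕ} {Ω : Opens (Fin N → ℝ)}

/-- The composition of a test function with a smooth function vanishing at `0`. -/
noncomputable def compTest (f : ℝ → ℝ) (hf : ContDiff ℝ ∞ f) (h0 : f 0 = 0) (φ : 𝓓(Ω, ℝ)) :
    𝓓(Ω, ℝ) where
  toFun := f ∘ φ
  contDiff' := hf.comp φ.contDiff
  hasCompactSupport' := φ.hasCompactSupport.comp_left h0
  tsupport_subset' := (tsupport_comp_subset h0 _).trans φ.tsupport_subset

theorem compTest_apply (f : ℝ → ℝ) (hf : ContDiff ℝ ∞ f) (h0 : f 0 = 0) (φ : 𝓓(Ω, ℝ))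
    (x : Fin N → ℝ) : compTest f hf h0 φ x = f (φ x) := rfl

theorem partialDeriv_compTest (f : ℝ → ℝ) (hf : ContDiff ℝ ∞ f) (h0 : f 0 = 0) (φ : 𝓓(Ω, ℝ))
    (i : Fin N) (x : Fin N → ℝ) :
    partialDeriv i (compTest f hf h0 φ) x = deriv f (φ x) * partialDeriv i φ x := by
  have h1 : DifferentiableAt ℝ f (φ x) := hf.differentiable (by simp) _
  have h2 : DifferentiableAt ℝ φ x := φ.contDiff.differentiable (by simp) x
  change fderiv ℝ (f ∘ φ) x _ = _
  rw [fderiv_comp x h1 h2]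
  simp [partialDeriv, mul_comm]

theorem continuous_partialDeriv (φ : 𝓓(Ω, ℝ)) (i : Fin N) : Continuous (partialDeriv i φ) :=
  (φ.contDiff.continuous_fderiv (by simp)).clm_apply continuous_const

theorem hasCompactSupport_partialDeriv (φ : 𝓓(Ω, ℝ)) (i : Fin N) :
    HasCompactSupport (partialDeriv i φ) :=
  φ.hasCompactSupport.fderiv_apply (𝕜 := ℝ) (Pi.single i 1)

theorem testFunction_eq_zero (φ : 𝓓(Ω, ℝ)) {x : Fin N → ℝ} (hx : x ∉ (Ω : Set (Fin N → ℝ))) :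
    φ x = 0 :=
  image_eq_zero_of_notMem_tsupport fun h => hx (φ.tsupport_subset h)

theorem partialDeriv_eq_zero (φ : 𝓓(Ω, ℝ)) (i : Fin N) {x : Fin N → ℝ}
    (hx : x ∉ (Ω : Set (Fin N → ℝ))) : partialDeriv i φ x = 0 := by
  have : fderiv ℝ φ x = 0 :=
    image_eq_zero_of_notMem_tsupport fun h => hx (φ.tsupport_subset (tsupport_fderiv_subset ℝ h))
  simp [partialDeriv, this]

/-- The Poincaré inequality in `L¹`, in the direction `i`, for nonnegative test functions. -/
theorem lintegral_testFunction_le (ψ : 𝓓(Ω, ℝ)) (hψ : ∀ x, 0 ≤ ψ x) (i : Fin N) {R : ℝ}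
    (hR : ∀ x ∈ Ω, |x i| ≤ R) :
    ∫⁻ x in (Ω : Set (Fin N → ℝ)), ‖ψ x‖ₑ
      ≤ ENNReal.ofReal R * ∫⁻ x in (Ω : Set (Fin N → ℝ)), ‖partialDeriv i ψ x‖ₑ := by
  have hc := continuous_partialDeriv ψ i
  have hs := hasCompactSupport_partialDeriv ψ i
  have hi : Continuous fun x : Fin N → ℝ => x i := continuous_apply i
  have hd : ∀ x : Fin N → ℝ, fderiv ℝ (fun x : Fin N → ℝ => x i) x (Pi.single i 1) = 1 := by
    intro x
    have : (fun x : Fin N → ℝ => x i) = ContinuousLinearMap.proj (R := ℝ) i := rfl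
    rw [this, ContinuousLinearMap.fderiv]
    simp
  have hψi : Integrable ψ volume := ψ.continuous.integrable_of_hasCompactSupport ψ.hasCompactSupport
  have hpi : Integrable (partialDeriv i ψ) volume := hc.integrable_of_hasCompactSupport hs
  -- Integration by parts against the coordinate function: ∫ ψ = -∫ x_i ∂_i ψ, and |x_i| ≤ R
  -- wherever ∂_i ψ can be nonzero.
  have e := integral_mul_fderiv_eq_neg_fderiv_mul_of_integrable (μ := volume) (𝕜 := ℝ)
    (f := fun x : Fin N → ℝ => x i) (g := ψ) (v := Pi.single i 1)
    (by simpa [hd] using hψi)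
    ((hi.mul hc).integrable_of_hasCompactSupport hs.mul_left)
    ((hi.mul ψ.continuous).integrable_of_hasCompactSupport ψ.hasCompactSupport.mul_left)
    (fun x _ => by fun_prop)
    (fun x _ => (ψ.contDiff.differentiable (by simp)) x)
  simp only [hd, one_mul] at e
  have hle : ∫ x, ψ x ≤ ∫ x, R * |partialDeriv i ψ x| := by
    rw [← neg_eq_iff_eq_neg.2 e, ← integral_neg]
    refine integral_mono ((hi.mul hc).integrable_of_hasCompactSupport hs.mul_left).neg
      (hpi.abs.const_mul R) fun x => ?_
    by_cases hx : x ∈ Ω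
    · refine (neg_le_abs _).trans ?_
      rw [abs_mul]
      exact mul_le_mul_of_nonneg_right (hR x hx) (abs_nonneg _)
    · have : fderiv ℝ ψ x (Pi.single i 1) = 0 := partialDeriv_eq_zero ψ i hx
      simp [partialDeriv, this]
  have e1 : ∫⁻ x in (Ω : Set (Fin N → ℝ)), ‖partialDeriv i ψ x‖ₑ
      = ∫⁻ x, ‖partialDeriv i ψ x‖ₑ := by
    refine setLIntegral_eq_of_support_subset fun x hx => ?_
    by_contra h
    exact hx (by simp [partialDeriv_eq_zero ψ i h])
  rw [e1]
  refine (setLIntegral_le_lintegral _ _).trans ?_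
  -- Nonnegativity of `R` comes from a point of `Ω`, so the empty set is treated apart.
  rcases (Ω : Set (Fin N → ℝ)).eq_empty_or_nonempty with h0 | ⟨y, hy⟩
  · have : ∀ x, ψ x = 0 := fun x => testFunction_eq_zero ψ (by simp [h0])
    simp [this]
  have hR0 : 0 ≤ R := (abs_nonneg _).trans (hR y hy)
  rw [integral_const_mul] at hle
  have e2 : ∫⁻ x, ‖ψ x‖ₑ = ENNReal.ofReal (∫ x, ψ x) := by
    rw [ofReal_integral_eq_lintegral_ofReal hψi (Eventually.of_forall hψ)]
    exact lintegral_congr fun x => Real.enorm_of_nonneg (hψ x)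
  have e3 : ∫⁻ x, ‖partialDeriv i ψ x‖ₑ = ENNReal.ofReal (∫ x, |partialDeriv i ψ x|) := by
    rw [ofReal_integral_eq_lintegral_ofReal hpi.abs (Eventually.of_forall fun x => abs_nonneg _)]
    exact lintegral_congr fun x => by rw [Real.enorm_eq_ofReal_abs]
  rw [e2, e3, ← ENNReal.ofReal_mul hR0]
  exact ENNReal.ofReal_le_ofReal hle

/-- Rescaling the axes with total factor 1 preserves volume; this is how weights enter the
Gagliardo–Nirenberg inequality. -/
theorem pi_smul_volume_of_prod_eq_one (c : Fin N → ℝ≥0) (hc : ∏ i, c i = 1) :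
    Measure.pi (fun i => (c i) • (volume : Measure ℝ)) = volume := by
  refine Measure.pi_eq fun s hs => ?_
  simp only [Measure.smul_apply, ENNReal.smul_def, smul_eq_mul]
  rw [Finset.prod_mul_distrib, ← ENNReal.ofNNReal_finsetProd, hc, volume_pi_pi]
  simp

/-- The Gagliardo–Nirenberg inequality in `W^{1,1}`, with weights on the coordinate directions. -/
theorem lintegral_testFunction_rpow_le {q : ℝ} (hq : Real.HolderConjugate N q) (ψ : 𝓓(Ω, ℝ))
    (c : Fin N → ℝ≥0) (hc : ∏ i, c i = 1) :
    ∫⁻ x in (Ω : Set (Fin N → ℝ)), ‖ψ x‖ₑ ^ q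
      ≤ (∑ i, c i * ∫⁻ x in (Ω : Set (Fin N → ℝ)), ‖partialDeriv i ψ x‖ₑ) ^ q := by
  have hc0 : ∀ i, c i ≠ 0 := fun i h => by
    rw [Finset.prod_eq_zero (Finset.mem_univ i) h] at hc
    exact zero_ne_one hc
  have hN1 : (1 : ℝ) < N := hq.lt
  have hq0 : 0 ≤ q := hq.symm.nonneg
  let f : (Fin N → ℝ) → ℝ≥0∞ := fun x => ∑ i, c i * ‖partialDeriv i ψ x‖ₑ
  have hf : Measurable f := Finset.measurable_sum _ fun i _ =>
    ((continuous_partialDeriv ψ i).measurable.enorm).const_mul _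
  -- The i-th axis carries Lebesgue measure divided by c_i, which cancels the weight c_i in `f` on
  -- lines parallel to that axis. The product measure is still Lebesgue measure.
  let ν : Fin N → Measure ℝ := fun i => (c i)⁻¹ • (volume : Measure ℝ)
  have hν : Measure.pi ν = volume := pi_smul_volume_of_prod_eq_one _ (by simp [hc])
  have h1 : ∀ x i, ‖ψ x‖ₑ ≤ ∫⁻ t, f (Function.update x i t) ∂ν i := by
    intro x i
    have hcs : HasCompactSupport (ψ ∘ Function.update x i) :=
      ψ.hasCompactSupport.comp_isClosedEmbedding (isClosedEmbedding_update x i)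
    have hcd : ContDiff ℝ 1 (ψ ∘ Function.update x i) :=
      (ψ.contDiff.of_le (by simp)).comp (by convert! contDiff_update 1 x i)
    calc ‖ψ x‖ₑ ≤ ∫⁻ t in Iic (x i), ‖deriv (ψ ∘ Function.update x i) t‖ₑ :=
          le_trans (by simp) (HasCompactSupport.enorm_le_lintegral_Ici_deriv hcd hcs (x i))
      _ ≤ ∫⁻ t, ‖deriv (ψ ∘ Function.update x i) t‖ₑ := setLIntegral_le_lintegral _ _
      _ = ∫⁻ t, ‖partialDeriv i ψ (Function.update x i t)‖ₑ := by
          refine lintegral_congr fun t => ?_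
          rw [fderiv_comp_deriv _ (ψ.contDiff.differentiable (by simp)).differentiableAt
            (hasDerivAt_update x i t).differentiableAt, deriv_update, partialDeriv]
      _ = ∫⁻ t, c i * ‖partialDeriv i ψ (Function.update x i t)‖ₑ ∂ν i := by
          have hm : Measurable fun t => ‖partialDeriv i ψ (Function.update x i t)‖ₑ :=
            ((continuous_partialDeriv ψ i).comp (continuous_const.update i continuous_id)
              ).measurable.enorm
          rw [lintegral_const_mul _ hm, lintegral_smul_measure, ENNReal.smul_def, smul_eq_mul,
            ← mul_assoc, ← ENNReal.coe_mul, mul_inv_cancel₀ (hc0 i), ENNReal.coe_one, one_mul]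
      _ ≤ ∫⁻ t, f (Function.update x i t) ∂ν i := by
          refine lintegral_mono fun t => ?_
          exact Finset.single_le_sum
            (f := fun j => (c j : ℝ≥0∞) * ‖partialDeriv j ψ (Function.update x i t)‖ₑ)
            (fun _ _ => zero_le) (Finset.mem_univ i)
  have hq' : Real.HolderConjugate (Fintype.card (Fin N)) q := by simpa using hq
  have h2 := lintegral_prod_lintegral_pow_le ν hq' hf
  rw [hν] at h2
  have h3 : ∫⁻ x, f x ≤ ∑ i, c i * ∫⁻ x in (Ω : Set (Fin N → ℝ)), ‖partialDeriv i ψ x‖ₑ := by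
    rw [lintegral_finsetSum _ fun i _ =>
      ((continuous_partialDeriv ψ i).measurable.enorm).const_mul _]
    refine Finset.sum_le_sum fun i _ => ?_
    rw [lintegral_const_mul _ (continuous_partialDeriv ψ i).measurable.enorm]
    refine mul_le_mul_right (le_of_eq ?_) _
    refine (setLIntegral_eq_of_support_subset fun x hx => ?_).symm
    by_contra h
    exact hx (by simp [partialDeriv_eq_zero ψ i h])
  calc ∫⁻ x in (Ω : Set (Fin N → ℝ)), ‖ψ x‖ₑ ^ q ≤ ∫⁻ x, ‖ψ x‖ₑ ^ q :=
        setLIntegral_le_lintegral _ _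
    _ ≤ ∫⁻ x, ∏ i, (∫⁻ t, f (Function.update x i t) ∂ν i) ^
          ((1 : ℝ) / (Fintype.card (Fin N) - 1 : ℝ)) := by
        refine lintegral_mono fun x => ?_
        -- N factors of exponent 1 / (N - 1), one for each direction, multiply to the exponent q = N
        -- / (N - 1).
        have e : ‖ψ x‖ₑ ^ q = ∏ _i : Fin N, ‖ψ x‖ₑ ^ ((1 : ℝ) / (N - 1 : ℝ)) := by
          rw [Finset.prod_const, Finset.card_univ, Fintype.card_fin, ← ENNReal.rpow_natCast,
            ← ENNReal.rpow_mul, hq.conjugate_eq]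
          congr 1
          ring
        rw [e, Fintype.card_fin]
        refine Finset.prod_le_prod' fun i _ => ?_
        exact ENNReal.rpow_le_rpow (h1 x i) (by
          have : (0 : ℝ) < N - 1 := by linarith
          positivity)
    _ ≤ _ := h2.trans (ENNReal.rpow_le_rpow h3 hq0)

end Test

/-! ### Passing to the limit -/

/-- Split V (c_n h_n - c h) = c_n V (h_n - h) + (c_n - c) V h. Hölder's inequality and the bound on
c_n handle the first term, dominated convergence the second. Thus c_n need only be bounded and
converge a.e. -/
theorem tendsto_lintegral_enorm_mul_sub {X : Type*} [MeasurableSpace X] {μ : Measure X}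
    {r s : ℝ≥0∞} [hrs : r.HolderConjugate s] {V h c : X → ℝ} {hn cn : ℕ → X → ℝ} {L : ℝ}
    (hV : MemLp V s μ) (hh : MemLp h r μ) (hhn : ∀ n, AEStronglyMeasurable (hn n) μ)
    (hcn : ∀ n, AEStronglyMeasurable (cn n) μ) (hbd : ∀ n x, |cn n x| ≤ L)
    (hlim : ∀ᵐ x ∂μ, Tendsto (fun n => cn n x) atTop (𝓝 (c x)))
    (hnorm : Tendsto (fun n => eLpNorm (fun x => hn n x - h x) r μ) atTop (𝓝 0)) :
    Tendsto (fun n => ∫⁻ x, ‖V x * (cn n x * hn n x) - V x * (c x * h x)‖ₑ ∂μ) atTop (𝓝 0) := by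
  have hVh : Integrable (fun x => V x * h x) μ := by
    have := hh.integrable_mul (q := s) hV
    exact this.congr (Eventually.of_forall fun x => mul_comm _ _)
  have h1 : Tendsto (fun n => ENNReal.ofReal L * (eLpNorm V s μ *
      eLpNorm (fun x => hn n x - h x) r μ)) atTop (𝓝 0) := by
    have := ENNReal.Tendsto.const_mul (a := ENNReal.ofReal L)
      (ENNReal.Tendsto.const_mul (a := eLpNorm V s μ) hnorm (Or.inr hV.eLpNorm_ne_top))
      (Or.inr ENNReal.ofReal_ne_top)
    simpa using this
  have hcm : AEStronglyMeasurable c μ := aestronglyMeasurable_of_tendsto_ae atTop hcn hlim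
  have h2 : Tendsto (fun n => ∫⁻ x, ‖(cn n x - c x) * (V x * h x)‖ₑ ∂μ) atTop (𝓝 0) := by
    have := tendsto_lintegral_of_dominated_convergence' (μ := μ)
      (F := fun n x => ‖(cn n x - c x) * (V x * h x)‖ₑ) (f := fun _ => 0)
      (fun x => ‖(2 * L) * (V x * h x)‖ₑ)
      (fun n => (((hcn n).sub hcm).mul hVh.aestronglyMeasurable).enorm) ?_ ?_ ?_
    · simpa using this
    · intro n
      filter_upwards [hlim] with x hx
      have hcL : |c x| ≤ L := le_of_tendsto hx.abs (Eventually.of_forall fun n => hbd n x)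
      change ‖(cn n x - c x) * (V x * h x)‖ₑ ≤ ‖(2 * L) * (V x * h x)‖ₑ
      rw [enorm_le_iff_norm_le, norm_mul (cn n x - c x), norm_mul (2 * L)]
      refine mul_le_mul_of_nonneg_right ?_ (norm_nonneg (V x * h x))
      refine (norm_sub_le _ _).trans ?_
      rw [Real.norm_eq_abs, Real.norm_eq_abs]
      exact (add_le_add (hbd n x) hcL).trans (by rw [← two_mul]; exact le_abs_self _)
    · exact (hVh.const_mul (2 * L)).2.ne
    · filter_upwards [hlim] with x hx
      have : Tendsto (fun n => (cn n x - c x) * (V x * h x)) atTop (𝓝 0) := by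
        simpa using (hx.sub_const (c x)).mul_const (V x * h x)
      simpa using this.enorm
  have h3 := h1.add h2
  rw [add_zero] at h3
  refine tendsto_of_tendsto_of_tendsto_of_le_of_le tendsto_const_nhds h3 (fun _ => zero_le)
    fun n => ?_
  have e : ∀ x, ‖V x * (cn n x * hn n x) - V x * (c x * h x)‖ₑ
      ≤ ENNReal.ofReal L * ‖V x * (hn n x - h x)‖ₑ + ‖(cn n x - c x) * (V x * h x)‖ₑ := by
    intro x
    have : V x * (cn n x * hn n x) - V x * (c x * h x)
      = cn n x * (V x * (hn n x - h x)) + (cn n x - c x) * (V x * h x) := by ring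
    rw [this]
    refine (enorm_add_le _ _).trans (add_le_add_left ?_ _)
    rw [enorm_mul]
    refine mul_le_mul_left ?_ _
    rw [Real.enorm_eq_ofReal_abs]
    exact ENNReal.ofReal_le_ofReal (hbd n x)
  have hm : AEStronglyMeasurable (fun x => hn n x - h x) μ := (hhn n).sub hh.1
  have hVm : AEMeasurable (fun x => ‖V x * (hn n x - h x)‖ₑ) μ := (hV.1.mul hm).enorm
  refine (lintegral_mono e).trans ?_
  rw [lintegral_add_left' (hVm.const_mul _), lintegral_const_mul'' _ hVm]
  refine add_le_add_left (mul_le_mul_right ?_ _) _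
  have := eLpNorm_smul_le_mul_eLpNorm (p := s) (q := r) (r := 1) hm hV.1
    (hpqr := hrs.symm)
  rwa [eLpNorm_one_eq_lintegral_enorm] at this

theorem tendsto_integral_mul_mul {X : Type*} [MeasurableSpace X] {μ : Measure X}
    {r s : ℝ≥0∞} [hrs : r.HolderConjugate s] {V h c : X → ℝ} {hn cn : ℕ → X → ℝ} {L : ℝ}
    (hV : MemLp V s μ) (hh : MemLp h r μ) (hhn : ∀ n, MemLp (hn n) r μ)
    (hcn : ∀ n, AEStronglyMeasurable (cn n) μ) (hbd : ∀ n x, |cn n x| ≤ L)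
    (hlim : ∀ᵐ x ∂μ, Tendsto (fun n => cn n x) atTop (𝓝 (c x)))
    (hnorm : Tendsto (fun n => eLpNorm (fun x => hn n x - h x) r μ) atTop (𝓝 0)) :
    Tendsto (fun n => ∫ x, V x * (cn n x * hn n x) ∂μ) atTop (𝓝 (∫ x, V x * (c x * h x) ∂μ)) := by
  have hcm : AEStronglyMeasurable c μ := aestronglyMeasurable_of_tendsto_ae atTop hcn hlim
  have hint : ∀ {g d : X → ℝ}, MemLp g r μ → AEStronglyMeasurable d μ → (∀ᵐ x ∂μ, |d x| ≤ L) →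
      Integrable (fun x => V x * (d x * g x)) μ := by
    intro g d hg hd hdL
    have h0 : Integrable (fun x => V x * g x) μ := by
      have := hg.integrable_mul (q := s) hV
      exact this.congr (Eventually.of_forall fun x => mul_comm _ _)
    refine (h0.bdd_mul hd (c := L) hdL).congr (Eventually.of_forall fun x => ?_)
    simp only
    ring
  refine tendsto_integral_of_L1 _ (hint hh hcm ?_).aestronglyMeasurable ?_ ?_
  · filter_upwards [hlim] with x hx
    exact le_of_tendsto hx.abs (Eventually.of_forall fun n => hbd n x)
  · exact Eventually.of_forall fun n => hint (hhn n) (hcn n) (Eventually.of_forall (hbd n))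
  · exact tendsto_lintegral_enorm_mul_sub hV hh (fun n => (hhn n).1) hcn hbd hlim hnorm

/-! ### Approximation by test functions and bounds on superlevel sets -/

section Space

variable {N : ℕ} {p : Fin N → ℝ} {Ω : Opens (Fin N → ℝ)} [hp : ∀ i, Fact (1 < p i)]

theorem memLp_w0Grad (u : AnisotropicW0 p Ω) (i : Fin N) :
    MemLp (fun x => w0Grad u x i) (ENNReal.ofReal (p i))
      (volume.restrict (Ω : Set (Fin N → ℝ))) :=
  Lp.memLp _

theorem stronglyMeasurable_w0Fun (u : AnisotropicW0 p Ω) : StronglyMeasurable (w0Fun u) :=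
  Lp.stronglyMeasurable _

theorem measurable_w0Grad (u : AnisotropicW0 p Ω) : Measurable (w0Grad u) :=
  measurable_pi_lambda _ fun _ => (Lp.stronglyMeasurable _).measurable

/-- L¹ convergence of the functions gives a.e. convergence along a subsequence, which suffices to
pass to the limit in bounded continuous functions of `u`. -/
theorem exists_seq_testFunction (u : AnisotropicW0 p Ω) :
    ∃ φ : ℕ → 𝓓(Ω, ℝ),
      (∀ᵐ x ∂volume.restrict (Ω : Set (Fin N → ℝ)),
        Tendsto (fun n => φ n x) atTop (𝓝 (w0Fun u x))) ∧
      ∀ i, Tendsto (fun n => eLpNorm (fun x => partialDeriv i (φ n) x - w0Grad u x i)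
        (ENNReal.ofReal (p i)) (volume.restrict (Ω : Set (Fin N → ℝ)))) atTop (𝓝 0) := by
  obtain ⟨v, hv, hlim⟩ := mem_closure_iff_seq_limit.1 u.2
  choose φ hφ using hv
  have h1 : Tendsto (fun n => (v n).1) atTop (𝓝 (u : PairSpace p Ω).1) :=
    (continuous_fst.tendsto _).comp hlim
  have h2 : ∀ i, Tendsto (fun n => (v n).2 i) atTop (𝓝 ((u : PairSpace p Ω).2 i)) := fun i =>
    (((continuous_apply i).comp continuous_snd).tendsto _).comp hlim
  obtain ⟨ns, hns, hae⟩ := (tendstoInMeasure_of_tendsto_Lp h1).exists_seq_tendsto_ae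
  refine ⟨fun n => φ (ns n), ?_, fun i => ?_⟩
  · have hall : ∀ᵐ x ∂volume.restrict (Ω : Set (Fin N → ℝ)), ∀ n, (v n).1 x = φ n x := by
      refine ae_all_iff.2 fun n => ?_
      rw [← hφ n]
      exact (memLp_testFunction (φ n) 1).coeFn_toLp
    filter_upwards [hae, hall] with x hx hx2
    simp only [hx2] at hx
    exact hx
  · have h3 := ((Lp.tendsto_Lp_iff_tendsto_eLpNorm' _ _).1 (h2 i)).comp hns.tendsto_atTop
    refine h3.congr fun n => eLpNorm_congr_ae ?_
    have : ((v (ns n)).2 i : (Fin N → ℝ) → ℝ)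
        =ᵐ[volume.restrict (Ω : Set (Fin N → ℝ))] partialDeriv i (φ (ns n)) := by
      rw [← hφ (ns n)]
      exact (memLp_partialDeriv (φ (ns n)) i (ENNReal.ofReal (p i))).coeFn_toLp
    filter_upwards [this] with x hx
    simp only [Pi.sub_apply, hx]
    rfl

/-- The integral of `|∂_i u|` over the layer `ε < |u| < 2 ε`, with a smooth weight. -/
noncomputable def layerIntegral (u : AnisotropicW0 p Ω) (ε : ℝ) (i : Fin N) : ℝ :=
  ∫ x in (Ω : Set (Fin N → ℝ)), deriv ramp (w0Fun u x / ε) * |w0Grad u x i|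

theorem measurable_deriv_ramp_w0Fun (u : AnisotropicW0 p Ω) (ε : ℝ) :
    Measurable fun x => deriv ramp (w0Fun u x / ε) :=
  continuous_deriv_ramp.measurable.comp ((stronglyMeasurable_w0Fun u).measurable.div_const ε)

theorem integrable_w0Grad [IsFiniteMeasure (volume.restrict (Ω : Set (Fin N → ℝ)))]
    (u : AnisotropicW0 p Ω) (i : Fin N) :
    Integrable (fun x => w0Grad u x i) (volume.restrict (Ω : Set (Fin N → ℝ))) :=
  (memLp_w0Grad u i).integrable Fact.out

theorem integrable_layer [IsFiniteMeasure (volume.restrict (Ω : Set (Fin N → ℝ)))]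
    (u : AnisotropicW0 p Ω) (ε : ℝ) (i : Fin N) :
    Integrable (fun x => deriv ramp (w0Fun u x / ε) * |w0Grad u x i|)
      (volume.restrict (Ω : Set (Fin N → ℝ))) := by
  obtain ⟨L, hL1, hL⟩ := exists_deriv_ramp_le
  refine (integrable_w0Grad u i).abs.bdd_mul (c := L)
    (measurable_deriv_ramp_w0Fun u ε).aestronglyMeasurable (Eventually.of_forall fun x => ?_)
  rw [Real.norm_of_nonneg (deriv_ramp_nonneg _)]
  exact hL _

theorem lintegral_deriv_ramp_sq_le [IsFiniteMeasure (volume.restrict (Ω : Set (Fin N → ℝ)))]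
    (u : AnisotropicW0 p Ω) {ε : ℝ} (hε : 0 < ε) (i : Fin N) :
    ∫⁻ x in (Ω : Set (Fin N → ℝ)),
      ‖deriv (fun y => ramp (y / ε) ^ 2) (w0Fun u x) * w0Grad u x i‖ₑ
      ≤ ENNReal.ofReal (2 / ε * layerIntegral u ε i) := by
  rw [layerIntegral, ← integral_const_mul, ofReal_integral_eq_lintegral_ofReal
    ((integrable_layer u ε i).const_mul _)
    (Eventually.of_forall fun x => mul_nonneg (by positivity)
      (mul_nonneg (deriv_ramp_nonneg _) (abs_nonneg _)))]
  refine lintegral_mono fun x => ?_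
  rw [Real.enorm_eq_ofReal_abs, deriv_ramp_div_sq]
  refine ENNReal.ofReal_le_ofReal ?_
  have h1 := abs_ramp_le_one (w0Fun u x / ε)
  have h2 := deriv_ramp_nonneg (w0Fun u x / ε)
  rw [abs_mul, abs_mul, abs_mul, abs_div, abs_of_nonneg h2, abs_of_pos hε, abs_two]
  calc 2 * |ramp (w0Fun u x / ε)| * (deriv ramp (w0Fun u x / ε) / ε) * |w0Grad u x i|
      ≤ 2 * 1 * (deriv ramp (w0Fun u x / ε) / ε) * |w0Grad u x i| := by gcongr
    _ = _ := by ring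

/-- A bound for superlevel sets that follows from an inequality for test functions between the
`L^r` norm of the function and the `L¹` norms of the partial derivatives. -/
theorem measure_le_of_testFunction_le [IsFiniteMeasure (volume.restrict (Ω : Set (Fin N → ℝ)))]
    (u : AnisotropicW0 p Ω) {ε : ℝ} (hε : 0 < ε) {r : ℝ} (hr : 0 < r) (K : Fin N → ℝ≥0)
    (hK : ∀ ψ : 𝓓(Ω, ℝ), (∀ x, 0 ≤ ψ x) →
      ∫⁻ x in (Ω : Set (Fin N → ℝ)), ‖ψ x‖ₑ ^ r
        ≤ (∑ i, K i * ∫⁻ x in (Ω : Set (Fin N → ℝ)), ‖partialDeriv i ψ x‖ₑ) ^ r) :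
    ε * (volume.restrict (Ω : Set (Fin N → ℝ))).real {x | 2 * ε ≤ |w0Fun u x|} ^ r⁻¹
      ≤ 2 * ∑ i, K i * layerIntegral u ε i := by
  set μ := volume.restrict (Ω : Set (Fin N → ℝ)) with hμ
  obtain ⟨φ, hφ, hgrad⟩ := exists_seq_testFunction u
  -- The square makes the truncation smooth and nonnegative, hence admissible in `hK`, and equal to
  -- 1 where |u| ≥ 2ε. It costs a factor 2 in the derivative.
  let f : ℝ → ℝ := fun y => ramp (y / ε) ^ 2
  have hf : ContDiff ℝ ∞ f := (contDiff_ramp_div ε).pow 2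
  have hf0 : f 0 = 0 := by simp [f, ramp_zero]
  have hf' : Continuous (deriv f) := hf.continuous_deriv (by simp)
  obtain ⟨L, hL1, hL⟩ := exists_deriv_ramp_le
  have hfL : ∀ y, |deriv f y| ≤ 2 * L / ε := by
    intro y
    have h1 := abs_ramp_le_one (y / ε)
    have h2 := deriv_ramp_nonneg (y / ε)
    have h3 := hL (y / ε)
    simp only [f, deriv_ramp_div_sq]
    rw [abs_mul, abs_mul, abs_div, abs_of_nonneg h2, abs_of_pos hε, abs_two]
    calc 2 * |ramp (y / ε)| * (deriv ramp (y / ε) / ε) ≤ 2 * 1 * (L / ε) := by gcongr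
      _ = _ := by ring
  -- L¹ error between ∂_i (f ∘ φ_n) and its limit f'(u) ∂_i u. Working with test functions up to the
  -- limit avoids a chain rule in the Sobolev space.
  let δ : ℕ → Fin N → ℝ≥0∞ := fun n i => ∫⁻ x, ‖1 * (deriv f (φ n x) * partialDeriv i (φ n) x)
    - 1 * (deriv f (w0Fun u x) * w0Grad u x i)‖ₑ ∂μ
  have hδ : ∀ i, Tendsto (fun n => δ n i) atTop (𝓝 0) := by
    intro i
    have hone : 1 ≤ ENNReal.ofReal (p i) := Fact.out
    have : (ENNReal.ofReal (p i)).HolderConjugate (1 - (ENNReal.ofReal (p i))⁻¹)⁻¹ :=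
      ENNReal.HolderConjugate.inv_one_sub_inv' hone
    refine tendsto_lintegral_enorm_mul_sub (V := fun _ => 1) (h := fun x => w0Grad u x i)
      (s := (1 - (ENNReal.ofReal (p i))⁻¹)⁻¹)
      (memLp_const 1) (memLp_w0Grad u i)
      (fun n => (continuous_partialDeriv (φ n) i).aestronglyMeasurable)
      (fun n => (hf'.comp (φ n).continuous).aestronglyMeasurable) (fun n x => hfL _) ?_ (hgrad i)
    filter_upwards [hφ] with x hx using (hf'.tendsto _).comp hx
  let J : Fin N → ℝ≥0∞ := fun i => ENNReal.ofReal (2 / ε * layerIntegral u ε i)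
  have hn : ∀ n, ∫⁻ x, ‖f (φ n x)‖ₑ ^ r ∂μ ≤ (∑ i, K i * (δ n i + J i)) ^ r := by
    intro n
    refine (hK (compTest f hf hf0 (φ n)) fun x => sq_nonneg _).trans ?_
    refine ENNReal.rpow_le_rpow ?_ hr.le
    refine Finset.sum_le_sum fun i _ => mul_le_mul_right ?_ _
    refine le_trans ?_ (add_le_add_right (lintegral_deriv_ramp_sq_le u hε i) _)
    rw [← lintegral_add_right _ (by
      exact ((hf'.measurable.comp (stronglyMeasurable_w0Fun u).measurable).mul
        ((measurable_pi_apply i).comp (measurable_w0Grad u))).enorm)]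
    refine lintegral_mono fun x => ?_
    rw [partialDeriv_compTest]
    simp only [one_mul]
    refine le_trans (le_of_eq ?_) (enorm_add_le _ _)
    congr 1
    simp [f]
  have hlim : Tendsto (fun n => (∑ i, K i * (δ n i + J i)) ^ r) atTop
      (𝓝 ((∑ i, K i * J i) ^ r)) := by
    refine ((ENNReal.continuous_rpow_const).tendsto _).comp (tendsto_finsetSum _ fun i _ => ?_)
    refine ENNReal.Tendsto.const_mul ?_ (Or.inr ENNReal.coe_ne_top)
    simpa using (hδ i).add_const (J i)
  -- Only Fatou's lemma is used on the left, so no strong convergence in L^r is required.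
  have hfatou : ∫⁻ x, ‖f (w0Fun u x)‖ₑ ^ r ∂μ ≤ (∑ i, K i * J i) ^ r := by
    calc ∫⁻ x, ‖f (w0Fun u x)‖ₑ ^ r ∂μ
        = ∫⁻ x, liminf (fun n => ‖f (φ n x)‖ₑ ^ r) atTop ∂μ := by
          refine lintegral_congr_ae ?_
          filter_upwards [hφ] with x hx
          refine (Tendsto.liminf_eq ?_).symm
          exact ((ENNReal.continuous_rpow_const).tendsto _).comp
            ((hf.continuous.tendsto _).comp hx).enorm
      _ ≤ liminf (fun n => ∫⁻ x, ‖f (φ n x)‖ₑ ^ r ∂μ) atTop :=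
          lintegral_liminf_le fun n =>
            (hf.continuous.comp (φ n).continuous).measurable.enorm.pow_const r
      _ ≤ liminf (fun n => (∑ i, K i * (δ n i + J i)) ^ r) atTop :=
          liminf_le_liminf (Eventually.of_forall hn)
      _ = _ := hlim.liminf_eq
  have hJ : ∑ i, K i * J i = ENNReal.ofReal (2 / ε * ∑ i, K i * layerIntegral u ε i) := by
    have hnn : ∀ i, 0 ≤ layerIntegral u ε i := fun i =>
      integral_nonneg fun x => mul_nonneg (deriv_ramp_nonneg _) (abs_nonneg _)
    rw [Finset.mul_sum, ENNReal.ofReal_sum_of_nonneg]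
    · refine Finset.sum_congr rfl fun i _ => ?_
      rw [← ENNReal.ofReal_coe_nnreal, ← ENNReal.ofReal_mul (by positivity)]
      congr 1
      ring
    · intro i _
      have := hnn i
      positivity
  have hset : μ {x | 2 * ε ≤ |w0Fun u x|} ≤ ∫⁻ x, ‖f (w0Fun u x)‖ₑ ^ r ∂μ := by
    have hms : MeasurableSet {x | 2 * ε ≤ |w0Fun u x|} :=
      measurableSet_le measurable_const (stronglyMeasurable_w0Fun u).measurable.abs
    rw [← lintegral_indicator_one hms]
    refine lintegral_mono fun x => ?_
    refine indicator_le_indicator_of_subset (f := fun _ => (1 : ℝ≥0∞)) (subset_refl _)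
      (fun _ => zero_le) x |>.trans ?_
    by_cases hx : x ∈ {x | 2 * ε ≤ |w0Fun u x|}
    · have : |ramp (w0Fun u x / ε)| = 1 := abs_ramp_eq_one (by
        rw [abs_div, abs_of_pos hε, le_div_iff₀ hε]
        exact hx)
      rw [indicator_of_mem hx, Real.enorm_eq_ofReal_abs]
      simp [f, this]
    · rw [indicator_of_notMem hx]
      exact zero_le
  have h := hset.trans hfatou
  rw [hJ] at h
  have hS : 0 ≤ 2 / ε * ∑ i, K i * layerIntegral u ε i := by
    have hnn : ∀ i, 0 ≤ layerIntegral u ε i := fun i =>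
      integral_nonneg fun x => mul_nonneg (deriv_ramp_nonneg _) (abs_nonneg _)
    have : 0 ≤ ∑ i, K i * layerIntegral u ε i :=
      Finset.sum_nonneg fun i _ => mul_nonneg (K i).2 (hnn i)
    positivity
  rw [ENNReal.ofReal_rpow_of_nonneg hS hr.le] at h
  have h' : μ.real {x | 2 * ε ≤ |w0Fun u x|} ≤ (2 / ε * ∑ i, K i * layerIntegral u ε i) ^ r :=
    ENNReal.toReal_le_of_le_ofReal (by positivity) h
  have h'' := Real.rpow_le_rpow measureReal_nonneg h' (inv_nonneg.2 hr.le)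
  rw [Real.rpow_rpow_inv hS hr.ne'] at h''
  calc ε * μ.real {x | 2 * ε ≤ |w0Fun u x|} ^ r⁻¹
      ≤ ε * (2 / ε * ∑ i, K i * layerIntegral u ε i) := by gcongr
    _ = _ := by field_simp

theorem mul_measureReal_le_layerIntegral
    [IsFiniteMeasure (volume.restrict (Ω : Set (Fin N → ℝ)))]
    (u : AnisotropicW0 p Ω) {R : ℝ≥0} (i : Fin N) (hR : ∀ x ∈ Ω, |x i| ≤ R) {ε : ℝ} (hε : 0 < ε) :
    ε * (volume.restrict (Ω : Set (Fin N → ℝ))).real {x | 2 * ε ≤ |w0Fun u x|}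
      ≤ 2 * (R * layerIntegral u ε i) := by
  classical
  -- Weights concentrated on direction i: the estimate then involves the single exponent p_i.
  have h := measure_le_of_testFunction_le u hε one_pos (Pi.single i R) fun ψ hψ => by
    simp only [ENNReal.rpow_one]
    refine (lintegral_testFunction_le ψ hψ i hR).trans ?_
    rw [Finset.sum_eq_single i]
    · simp
    · intro j _ hj
      simp [Pi.single_eq_of_ne hj]
    · simp
  rw [Finset.sum_eq_single i] at h
  · simpa using h
  · intro j _ hj
    simp [Pi.single_eq_of_ne hj]
  · simp

theorem mul_measureReal_rpow_le_layerIntegral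
    [IsFiniteMeasure (volume.restrict (Ω : Set (Fin N → ℝ)))] (hN : 1 < N)
    (u : AnisotropicW0 p Ω) (c : Fin N → ℝ≥0) (hc : ∏ i, c i = 1) {ε : ℝ} (hε : 0 < ε) :
    ε * (volume.restrict (Ω : Set (Fin N → ℝ))).real {x | 2 * ε ≤ |w0Fun u x|}
        ^ (1 - 1 / (N : ℝ))
      ≤ 2 * ∑ i, c i * layerIntegral u ε i := by
  have hq : Real.HolderConjugate N (Real.conjExponent N) :=
    Real.HolderConjugate.conjExponent (by exact_mod_cast hN)
  have h := measure_le_of_testFunction_le u hε hq.symm.pos c fun ψ _ =>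
    lintegral_testFunction_rpow_le hq ψ c hc
  rwa [← hq.one_sub_inv, inv_eq_one_div] at h

end Space

/-! ### Dyadic decompositions -/

/-- Summing the recursion bounds each partial sum by m_0 plus half the previous one plus ∑ A, which
keeps all of them below 2 (m_0 + ∑ A). -/
theorem summable_of_le_half_add {m A : ℕ → ℝ} (hm : ∀ k, 0 ≤ m k) (hA0 : ∀ k, 0 ≤ A k)
    (hA : Summable A) (h : ∀ k, m (k + 1) ≤ 1 / 2 * m k + A k) : Summable m := by
  have hS : ∀ n, ∑ k ∈ Finset.range n, m k ≤ 2 * (m 0 + ∑' k, A k) := by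
    intro n
    induction n with
    | zero =>
      have : 0 ≤ ∑' k, A k := tsum_nonneg hA0
      have := hm 0
      simp only [Finset.range_zero, Finset.sum_empty]
      positivity
    | succ n ih =>
      rw [Finset.sum_range_succ']
      have h1 : ∑ k ∈ Finset.range n, m (k + 1)
          ≤ 1 / 2 * ∑ k ∈ Finset.range n, m k + ∑ k ∈ Finset.range n, A k := by
        rw [Finset.mul_sum, ← Finset.sum_add_distrib]
        exact Finset.sum_le_sum fun k _ => h k
      have h2 := hA.sum_le_tsum (Finset.range n) fun k _ => hA0 k
      linarith
  exact summable_of_sum_range_le hm hS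

/-- A dichotomy yields the recursion of `summable_of_le_half_add`. If M drops by the factor δ from k
to k + 1, the weighted term halves. Otherwise M_k ≤ M_{k+1} / δ, and the power q - 1 of M_{k+1}
cancels from the hypothesis, leaving a multiple of A_k. -/
theorem summable_of_superlevel_decay {M A : ℕ → ℝ} (hM : ∀ k, 0 ≤ M k) (hA0 : ∀ k, 0 ≤ A k)
    (hA : Summable A) {q θ C : ℝ} (hq : 1 < q) (hθ : 0 < θ) (hC : 0 ≤ C)
    (h : ∀ k, ((2 : ℝ) ^ k) ^ q * M (k + 1) ^ (q - 1 + θ) ≤ C * A k * M k ^ (q - 1)) :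
    Summable fun k => ((2 : ℝ) ^ k) ^ q * M k ^ θ := by
  -- Chosen so that 2^q δ^θ = 1/2, where 2^q is the growth of the weight in one step.
  let δ : ℝ := ((2 : ℝ) ^ (-q - 1)) ^ (1 / θ)
  have hδ : 0 < δ := by positivity
  have hδθ : (2 : ℝ) ^ q * δ ^ θ = 1 / 2 := by
    rw [← Real.rpow_mul (by positivity), one_div_mul_cancel hθ.ne', Real.rpow_one,
      ← Real.rpow_add two_pos]
    rw [show q + (-q - 1) = -1 by ring, Real.rpow_neg_one, one_div]
  refine summable_of_le_half_add (A := fun k => 2 ^ q * (C / δ ^ (q - 1)) * A k)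
    (fun k => by have := hM k; positivity) (fun k => by have := hA0 k; positivity)
    (hA.mul_left _) fun k => ?_
  have e : ((2 : ℝ) ^ (k + 1)) ^ q = 2 ^ q * (2 ^ k) ^ q := by
    rw [pow_succ, Real.mul_rpow (by positivity) (by positivity), mul_comm]
  have hMk := hM k
  have hMk1 := hM (k + 1)
  have hAk := hA0 k
  rw [e]
  rcases le_or_gt (M (k + 1)) (δ * M k) with hle | hlt
  · have h1 : M (k + 1) ^ θ ≤ δ ^ θ * M k ^ θ := by
      rw [← Real.mul_rpow hδ.le hMk]
      exact Real.rpow_le_rpow hMk1 hle hθ.le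
    calc 2 ^ q * (2 ^ k) ^ q * M (k + 1) ^ θ
        ≤ 2 ^ q * (2 ^ k) ^ q * (δ ^ θ * M k ^ θ) := by gcongr
      _ = (2 ^ q * δ ^ θ) * ((2 ^ k) ^ q * M k ^ θ) := by ring
      _ = 1 / 2 * ((2 ^ k) ^ q * M k ^ θ) := by rw [hδθ]
      _ ≤ _ := le_add_of_nonneg_right (by positivity)
  · have hpos : 0 < M (k + 1) := lt_of_le_of_lt (by positivity) hlt
    have h1 : M k ^ (q - 1) ≤ M (k + 1) ^ (q - 1) / δ ^ (q - 1) := by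
      rw [← Real.div_rpow hMk1 hδ.le]
      refine Real.rpow_le_rpow hMk ?_ (by linarith)
      rw [le_div_iff₀ hδ]
      linarith
    have h2 := (h k).trans (mul_le_mul_of_nonneg_left h1 (by positivity))
    rw [Real.rpow_add hpos] at h2
    have hpp : 0 < M (k + 1) ^ (q - 1) := by positivity
    have h3 : (2 ^ k) ^ q * M (k + 1) ^ θ ≤ C / δ ^ (q - 1) * A k := by
      refine le_of_mul_le_mul_right ?_ hpp
      calc (2 ^ k) ^ q * M (k + 1) ^ θ * M (k + 1) ^ (q - 1)
          = (2 ^ k) ^ q * (M (k + 1) ^ (q - 1) * M (k + 1) ^ θ) := by ring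
        _ ≤ _ := h2
        _ = _ := by ring
    calc 2 ^ q * (2 ^ k) ^ q * M (k + 1) ^ θ
        = 2 ^ q * ((2 ^ k) ^ q * M (k + 1) ^ θ) := by ring
      _ ≤ 2 ^ q * (C / δ ^ (q - 1) * A k) := by gcongr
      _ = 2 ^ q * (C / δ ^ (q - 1)) * A k := by ring
      _ ≤ _ := le_add_of_nonneg_left (by positivity)

/-- Where |U| < 1 the factor is at most 1; where 2^k ≤ |U| < 2^{k+1} the k-th term alone dominates.
-/
theorem lintegral_mul_rpow_le_tsum {X : Type*} [MeasurableSpace X] {μ : Measure X}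
    {w : X → ℝ≥0∞} (hw : AEMeasurable w μ) {U : X → ℝ} (hU : Measurable U) {s : ℝ} (hs : 0 ≤ s) :
    ∫⁻ x, w x * ENNReal.ofReal (|U x| ^ s) ∂μ
      ≤ ∫⁻ x, w x ∂μ + ∑' k : ℕ, ENNReal.ofReal (((2 : ℝ) ^ (k + 1)) ^ s)
        * ∫⁻ x in {x | (2 : ℝ) ^ k ≤ |U x|}, w x ∂μ := by
  have hms : ∀ k : ℕ, MeasurableSet {x | (2 : ℝ) ^ k ≤ |U x|} := fun k =>
    measurableSet_le measurable_const hU.abs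
  have e : ∑' k : ℕ, ENNReal.ofReal (((2 : ℝ) ^ (k + 1)) ^ s)
        * ∫⁻ x in {x | (2 : ℝ) ^ k ≤ |U x|}, w x ∂μ
      = ∫⁻ x, ∑' k : ℕ, ENNReal.ofReal (((2 : ℝ) ^ (k + 1)) ^ s)
        * {x | (2 : ℝ) ^ k ≤ |U x|}.indicator w x ∂μ := by
    rw [lintegral_tsum fun k => (hw.indicator (hms k)).const_mul _]
    refine tsum_congr fun k => ?_
    rw [lintegral_const_mul'' _ (hw.indicator (hms k)), lintegral_indicator (hms k)]
  rw [e, ← lintegral_add_left' hw]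
  refine lintegral_mono fun x => ?_
  rcases le_or_gt 1 (|U x|) with h1 | h1
  · obtain ⟨k, hk1, hk2⟩ := exists_nat_pow_near h1 one_lt_two
    refine le_trans ?_ (le_add_of_nonneg_left zero_le)
    refine le_trans ?_ (ENNReal.le_tsum k)
    rw [indicator_of_mem (by exact hk1), mul_comm]
    gcongr
  · refine le_trans ?_ (le_add_of_nonneg_right zero_le)
    refine mul_le_of_le_one_right zero_le ?_
    rw [ENNReal.ofReal_le_one]
    exact Real.rpow_le_one (abs_nonneg _) h1.le hs

/-- Layer cake formula: {t < w} ∩ E has measure at most |E| for small t, and at most C t^{-r} for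
large t. -/
theorem exists_setLIntegral_le_of_weak {X : Type*} [MeasurableSpace X] {μ : Measure X}
    [IsFiniteMeasure μ] {w : X → ℝ} (hw0 : 0 ≤ᵐ[μ] w) (hw : AEMeasurable w μ) {r C : ℝ}
    (hr : 1 < r)
    (h : ∀ t : ℝ, 0 < t → ENNReal.ofReal (t ^ r) * μ {x | t < w x} ≤ ENNReal.ofReal C) :
    ∃ C' : ℝ, 0 ≤ C' ∧ ∀ E : Set X,
      ∫⁻ x in E, ENNReal.ofReal (w x) ∂μ ≤ ENNReal.ofReal (C' * μ.real E ^ (1 - 1 / r)) := by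
  have hr1 : 0 < r - 1 := by linarith
  refine ⟨1 + max C 0 / (r - 1), by positivity, fun E => ?_⟩
  rcases eq_or_ne (μ E) 0 with hE | hE
  · rw [Measure.restrict_eq_zero.2 hE, lintegral_zero_measure]
    exact zero_le
  set m := μ.real E with hm
  have hmpos : 0 < m := ENNReal.toReal_pos hE (measure_ne_top _ _)
  -- The height at which both bounds give a multiple of m^{1 - 1/r}.
  let τ : ℝ := m ^ (-(1 / r))
  have hτ : 0 < τ := by positivity
  rw [lintegral_eq_lintegral_meas_lt _ (ae_restrict_of_ae hw0) hw.restrict,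
    ← Ioc_union_Ioi_eq_Ioi hτ.le]
  refine (lintegral_union_le _ _ _).trans ?_
  have h1 : ∫⁻ t in Ioc 0 τ, (μ.restrict E) {x | t < w x} ≤ ENNReal.ofReal (m ^ (1 - 1 / r)) := by
    calc ∫⁻ t in Ioc 0 τ, (μ.restrict E) {x | t < w x} ≤ ∫⁻ t in Ioc 0 τ, μ E :=
          lintegral_mono fun t => (measure_mono (subset_univ _)).trans (by simp)
      _ = ENNReal.ofReal (m ^ (1 - 1 / r)) := by
          rw [setLIntegral_const, Real.volume_Ioc, sub_zero, ← ofReal_measureReal,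
            ← ENNReal.ofReal_mul measureReal_nonneg, ← hm]
          congr 1
          simp only [τ]
          rw [sub_eq_add_neg, Real.rpow_add hmpos, Real.rpow_one]
  have h2 : ∫⁻ t in Ioi τ, (μ.restrict E) {x | t < w x}
      ≤ ENNReal.ofReal (max C 0 / (r - 1) * m ^ (1 - 1 / r)) := by
    calc ∫⁻ t in Ioi τ, (μ.restrict E) {x | t < w x}
        ≤ ∫⁻ t in Ioi τ, ENNReal.ofReal (max C 0 * t ^ (-r)) := by
          refine setLIntegral_mono' measurableSet_Ioi fun t ht => ?_
          have ht0 : 0 < t := hτ.trans ht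
          refine (Measure.restrict_apply_le _ _).trans ?_
          have h3 := (h t ht0).trans (ENNReal.ofReal_le_ofReal (le_max_left C 0))
          have htr : 0 < t ^ r := by positivity
          rw [Real.rpow_neg ht0.le, ← div_eq_mul_inv, ENNReal.ofReal_div_of_pos htr,
            ENNReal.le_div_iff_mul_le (Or.inl (by simpa using htr))
              (Or.inl ENNReal.ofReal_ne_top), mul_comm]
          exact h3
      _ = ENNReal.ofReal (∫ t in Ioi τ, max C 0 * t ^ (-r)) := by
          rw [ofReal_integral_eq_lintegral_ofReal]
          · exact (integrableOn_Ioi_rpow_of_lt (by linarith) hτ).const_mul _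
          · filter_upwards [ae_restrict_mem measurableSet_Ioi] with t ht
            have ht0 : 0 < t := hτ.trans ht
            positivity
      _ = _ := by
          rw [integral_const_mul, integral_Ioi_rpow_of_lt (by linarith) hτ]
          congr 1
          have : τ ^ (-r + 1) = m ^ (1 - 1 / r) := by
            simp only [τ]
            rw [← Real.rpow_mul hmpos.le]
            congr 1
            field_simp
            ring
          rw [this, show -r + 1 = -(r - 1) by ring, neg_div_neg_eq]
          ring
  refine (add_le_add h1 h2).trans ?_
  rw [← ENNReal.ofReal_add (by positivity) (by positivity)]
  refine ENNReal.ofReal_le_ofReal (le_of_eq (by ring))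

/-! ### Exponents -/

section Exponents

variable {N : ℕ} {p : Fin N → ℝ} [hp : ∀ i, Fact (1 < p i)]

theorem one_lt_exponent (i : Fin N) : 1 < p i := Fact.out

theorem sum_inv_exponent (hN : 0 < N) (p : Fin N → ℝ) :
    ∑ i, 1 / p i = N / harmonicMean p := by
  have : (N : ℝ) ≠ 0 := by positivity
  rw [harmonicMean, div_inv_eq_mul, ← mul_assoc, mul_one_div_cancel this, one_mul]

theorem one_lt_harmonicMean (hN : 0 < N) (p : Fin N → ℝ) [hp : ∀ i, Fact (1 < p i)] :
    1 < harmonicMean p := by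
  have hN' : (0 : ℝ) < N := by exact_mod_cast hN
  have hne : (Finset.univ : Finset (Fin N)).Nonempty := ⟨⟨0, hN⟩, Finset.mem_univ _⟩
  have h1 : ∀ i, 0 < 1 / p i := fun i => by
    have := one_lt_exponent (p := p) i
    positivity
  have hpos : 0 < ∑ i, 1 / p i := Finset.sum_pos (fun i _ => h1 i) hne
  rw [harmonicMean]
  refine (one_lt_inv₀ (by positivity)).2 ?_
  have : ∑ i, 1 / p i < ∑ _i : Fin N, (1 : ℝ) := by
    refine Finset.sum_lt_sum_of_nonempty hne fun i _ => ?_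
    have := one_lt_exponent (p := p) i
    rw [div_lt_one (by linarith)]
    exact this
  rw [Finset.sum_const, Finset.card_univ, Fintype.card_fin, nsmul_one] at this
  rw [one_div, inv_mul_lt_iff₀ hN', mul_one]
  exact this

/-- A harmonic mean is at least the minimum. This supplies the direction used in the final argument.
-/
theorem exists_le_harmonicMean (hN : 0 < N) (p : Fin N → ℝ) [hp : ∀ i, Fact (1 < p i)] :
    ∃ i, p i ≤ harmonicMean p := by
  by_contra! h
  have hne : (Finset.univ : Finset (Fin N)).Nonempty := ⟨⟨0, hN⟩, Finset.mem_univ _⟩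
  have hP := one_lt_harmonicMean hN p
  have : ∑ i, 1 / p i < ∑ _i : Fin N, 1 / harmonicMean p :=
    Finset.sum_lt_sum_of_nonempty hne fun i _ =>
      one_div_lt_one_div_of_lt (by linarith) (h i)
  rw [Finset.sum_const, Finset.card_univ, Fintype.card_fin, nsmul_eq_mul, mul_one_div,
    sum_inv_exponent hN] at this
  exact lt_irrefl _ this

theorem conj_holderConjugate (i : Fin N) : (p i).HolderConjugate (conj (p i)) :=
  Real.HolderConjugate.conjExponent (one_lt_exponent i)

end Exponents

/-! ### Superlevel sets -/

section Space

variable {N : ℕ} {p : Fin N → ℝ} {Ω : Opens (Fin N → ℝ)} [hp : ∀ i, Fact (1 < p i)]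

/-- The measure of the superlevel set `{t ≤ |u|}`. -/
noncomputable def superlevel (u : AnisotropicW0 p Ω) (t : ℝ) : ℝ :=
  (volume.restrict (Ω : Set (Fin N → ℝ))).real {x | t ≤ |w0Fun u x|}

/-- The integral of `|∂_i u| ^ p i` with the weight of `layerIntegral`. -/
noncomputable def layerEnergy (u : AnisotropicW0 p Ω) (ε : ℝ) (i : Fin N) : ℝ :=
  ∫ x in (Ω : Set (Fin N → ℝ)), deriv ramp (w0Fun u x / ε) * |w0Grad u x i| ^ p i

theorem integrable_w0Grad_rpow (u : AnisotropicW0 p Ω) (i : Fin N) :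
    Integrable (fun x => |w0Grad u x i| ^ p i) (volume.restrict (Ω : Set (Fin N → ℝ))) := by
  have h0 : 0 < p i := one_pos.trans (one_lt_exponent i)
  have := (memLp_w0Grad u i).integrable_norm_rpow (by simpa using h0) ENNReal.ofReal_ne_top
  rwa [ENNReal.toReal_ofReal h0.le] at this

theorem integrable_deriv_ramp_mul {μ : Measure (Fin N → ℝ)} (u : AnisotropicW0 p Ω) (ε : ℝ)
    {g : (Fin N → ℝ) → ℝ} (hg : Integrable g μ) :
    Integrable (fun x => deriv ramp (w0Fun u x / ε) * g x) μ := by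
  obtain ⟨L, hL1, hL⟩ := exists_deriv_ramp_le
  refine hg.bdd_mul (c := L)
    (measurable_deriv_ramp_w0Fun u ε).aestronglyMeasurable (Eventually.of_forall fun x => ?_)
  rw [Real.norm_of_nonneg (deriv_ramp_nonneg _)]
  exact hL _

/-- Hölder's inequality for the weight σ, split as σ^{1/p} σ^{1/p'}. -/
theorem layerIntegral_le [IsFiniteMeasure (volume.restrict (Ω : Set (Fin N → ℝ)))]
    (u : AnisotropicW0 p Ω) (ε : ℝ) (i : Fin N) :
    layerIntegral u ε i ≤ layerEnergy u ε i ^ (1 / p i) *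
      (∫ x in (Ω : Set (Fin N → ℝ)), deriv ramp (w0Fun u x / ε)) ^ (1 - 1 / p i) := by
  set μ := volume.restrict (Ω : Set (Fin N → ℝ)) with hμ
  have hc := conj_holderConjugate (p := p) i
  have h0 : 0 < p i := hc.pos
  have h0' : 0 < conj (p i) := hc.symm.pos
  let σ : (Fin N → ℝ) → ℝ := fun x => deriv ramp (w0Fun u x / ε)
  have hσ : ∀ x, 0 ≤ σ x := fun x => deriv_ramp_nonneg _
  have hσm : Measurable σ := measurable_deriv_ramp_w0Fun u ε
  have hDm : Measurable fun x => |w0Grad u x i| :=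
    ((measurable_pi_apply i).comp (measurable_w0Grad u)).abs
  have e1 : ∀ x, (σ x ^ (1 / p i) * |w0Grad u x i|) ^ p i = σ x * |w0Grad u x i| ^ p i := by
    intro x
    rw [Real.mul_rpow (by have := hσ x; positivity) (abs_nonneg _), ← Real.rpow_mul (hσ x),
      one_div_mul_cancel h0.ne', Real.rpow_one]
  have e2 : ∀ x, (σ x ^ (1 / conj (p i))) ^ conj (p i) = σ x := by
    intro x
    rw [← Real.rpow_mul (hσ x), one_div_mul_cancel h0'.ne', Real.rpow_one]
  have e3 : 1 / conj (p i) = 1 - 1 / p i := by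
    rw [one_div, one_div, ← hc.one_sub_inv]
  have hm1 : MemLp (fun x => σ x ^ (1 / p i) * |w0Grad u x i|) (ENNReal.ofReal (p i)) μ := by
    have hm : AEStronglyMeasurable (fun x => σ x ^ (1 / p i) * |w0Grad u x i|) μ :=
      ((hσm.pow_const _).mul hDm).aestronglyMeasurable
    rw [← integrable_norm_rpow_iff hm
      (by simpa using h0) ENNReal.ofReal_ne_top, ENNReal.toReal_ofReal h0.le]
    refine (integrable_deriv_ramp_mul u ε (integrable_w0Grad_rpow u i)).congr
      (Eventually.of_forall fun x => ?_)
    simp only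
    rw [Real.norm_of_nonneg (by have := hσ x; positivity), e1]
  have hm2 : MemLp (fun x => σ x ^ (1 / conj (p i))) (ENNReal.ofReal (conj (p i))) μ := by
    rw [← integrable_norm_rpow_iff (hσm.pow_const _).aestronglyMeasurable
      (by simpa using h0') ENNReal.ofReal_ne_top, ENNReal.toReal_ofReal h0'.le]
    refine (integrable_deriv_ramp_mul u ε (integrable_const (1 : ℝ))).congr
      (Eventually.of_forall fun x => ?_)
    simp only
    rw [Real.norm_of_nonneg (by have := hσ x; positivity), e2, mul_one]
  have h := integral_mul_le_Lp_mul_Lq_of_nonneg hc (μ := μ)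
    (Eventually.of_forall fun x => by have := hσ x; positivity)
    (Eventually.of_forall fun x => by have := hσ x; positivity) hm1 hm2
  simp only [e1, e2] at h
  rw [e3] at h
  refine le_trans (le_of_eq ?_) h
  refine integral_congr_ae (Eventually.of_forall fun x => ?_)
  change σ x * |w0Grad u x i| = _
  rcases (hσ x).eq_or_lt with h | h
  · simp only [← h]
    rw [Real.zero_rpow (by positivity)]
    simp
  · simp only
    rw [mul_right_comm, ← Real.rpow_add h, add_sub_cancel, Real.rpow_one]

theorem layerEnergy_nonneg (u : AnisotropicW0 p Ω) (ε : ℝ) (i : Fin N) :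
    0 ≤ layerEnergy u ε i :=
  integral_nonneg fun x => mul_nonneg (deriv_ramp_nonneg _) (by positivity)

theorem superlevel_nonneg (u : AnisotropicW0 p Ω) (t : ℝ) : 0 ≤ superlevel u t :=
  measureReal_nonneg

/-- The layer `ε ≤ |u| < 2 ε`. -/
def layer (u : AnisotropicW0 p Ω) (ε : ℝ) : Set (Fin N → ℝ) :=
  {x | ε ≤ |w0Fun u x| ∧ |w0Fun u x| < 2 * ε}

theorem measurableSet_layer (u : AnisotropicW0 p Ω) (ε : ℝ) : MeasurableSet (layer u ε) :=
  (measurableSet_le measurable_const (stronglyMeasurable_w0Fun u).measurable.abs).inter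
    (measurableSet_lt (stronglyMeasurable_w0Fun u).measurable.abs measurable_const)

theorem deriv_ramp_eq_zero_of_notMem_layer (u : AnisotropicW0 p Ω) {ε : ℝ} (hε : 0 < ε)
    {x : Fin N → ℝ} (hx : x ∉ layer u ε) : deriv ramp (w0Fun u x / ε) = 0 := by
  refine deriv_ramp_eq_zero ?_
  rw [abs_div, abs_of_pos hε, div_le_iff₀ hε, le_div_iff₀ hε, one_mul]
  by_contra! h
  exact hx ⟨h.1.le, h.2⟩

theorem integral_deriv_ramp_mul_le {u : AnisotropicW0 p Ω} {ε L : ℝ} (hε : 0 < ε)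
    (hL : ∀ x, deriv ramp x ≤ L) {g : (Fin N → ℝ) → ℝ}
    (hg : Integrable g (volume.restrict (Ω : Set (Fin N → ℝ))))
    (hg0 : ∀ᵐ x ∂volume.restrict (Ω : Set (Fin N → ℝ)), 0 ≤ g x) :
    ∫ x in (Ω : Set (Fin N → ℝ)), deriv ramp (w0Fun u x / ε) * g x
      ≤ L * ∫ x in layer u ε, g x ∂volume.restrict (Ω : Set (Fin N → ℝ)) := by
  rw [← integral_indicator (measurableSet_layer u ε), ← integral_const_mul]
  refine integral_mono_ae (integrable_deriv_ramp_mul u ε hg)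
    ((hg.indicator (measurableSet_layer u ε)).const_mul L) ?_
  filter_upwards [hg0] with x hgx
  by_cases hx : x ∈ layer u ε
  · simp only [indicator_of_mem hx]
    exact mul_le_mul_of_nonneg_right (hL _) hgx
  · simp only [indicator_of_notMem hx, deriv_ramp_eq_zero_of_notMem_layer u hε hx]
    simp

/-- The smooth weight is replaced by L times the indicator of the layer. At dyadic heights these
layers are disjoint, so their energies are summable in k. -/
theorem layerIntegral_le_layer [IsFiniteMeasure (volume.restrict (Ω : Set (Fin N → ℝ)))]
    (u : AnisotropicW0 p Ω) {ε L : ℝ} (hε : 0 < ε) (hL0 : 0 ≤ L) (hL : ∀ x, deriv ramp x ≤ L)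
    (i : Fin N) :
    layerIntegral u ε i
      ≤ L * ((∫ x in layer u ε, |w0Grad u x i| ^ p i ∂volume.restrict (Ω : Set (Fin N → ℝ)))
        ^ (1 / p i) * superlevel u ε ^ (1 - 1 / p i)) := by
  have h1 : 1 < p i := one_lt_exponent i
  have h0 : 0 < p i := by linarith
  have h2 : 0 ≤ 1 - 1 / p i := by
    rw [sub_nonneg, div_le_one h0]
    exact h1.le
  have hE := integral_deriv_ramp_mul_le (u := u) hε hL (integrable_w0Grad_rpow u i)
    (Eventually.of_forall fun x => by positivity)
  have hM := integral_deriv_ramp_mul_le (u := u) hε hL (integrable_const (1 : ℝ))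
    (Eventually.of_forall fun x => zero_le_one)
  simp only [mul_one] at hM
  have hM' : ∫ x in (Ω : Set (Fin N → ℝ)), deriv ramp (w0Fun u x / ε) ≤ L * superlevel u ε := by
    refine hM.trans (mul_le_mul_of_nonneg_left ?_ hL0)
    rw [setIntegral_const, smul_eq_mul, mul_one]
    exact measureReal_mono fun x hx => hx.1
  have hint : 0 ≤ ∫ x in layer u ε, |w0Grad u x i| ^ p i
      ∂volume.restrict (Ω : Set (Fin N → ℝ)) := integral_nonneg fun x => by positivity
  refine (layerIntegral_le u ε i).trans ?_
  calc _ ≤ (L * ∫ x in layer u ε, |w0Grad u x i| ^ p i ∂volume.restrict (Ω : Set (Fin N → ℝ)))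
          ^ (1 / p i) * (L * superlevel u ε) ^ (1 - 1 / p i) := by
        refine mul_le_mul (Real.rpow_le_rpow (layerEnergy_nonneg u ε i) hE (by positivity))
          (Real.rpow_le_rpow (integral_nonneg fun x => deriv_ramp_nonneg _) hM' h2)
          (Real.rpow_nonneg (integral_nonneg fun x => deriv_ramp_nonneg _) _) (by positivity)
    _ = (L ^ (1 / p i) * L ^ (1 - 1 / p i)) * _ := by
        rw [Real.mul_rpow hL0 hint, Real.mul_rpow hL0 (superlevel_nonneg u ε), mul_mul_mul_comm]
    _ = _ := by
        rw [← Real.rpow_add_of_nonneg hL0 (by positivity) h2, add_sub_cancel, Real.rpow_one]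

/-! ### Dyadic Sobolev estimates for the superlevel sets -/

theorem pairwise_disjoint_layer (u : AnisotropicW0 p Ω) :
    Pairwise (Function.onFun Disjoint fun k : ℕ => layer u (2 ^ k)) := by
  have key : ∀ j k : ℕ, j < k → Disjoint (layer u (2 ^ j)) (layer u (2 ^ k)) := by
    intro j k hjk
    refine disjoint_left.2 fun x hx hx' => ?_
    have h1 : (2 : ℝ) * 2 ^ j ≤ 2 ^ k := by
      rw [← pow_succ']
      exact pow_le_pow_right₀ one_le_two hjk
    linarith [hx.2, hx'.1]
  intro j k hjk
  rcases hjk.lt_or_gt with h | h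
  · exact key j k h
  · exact (key k j h).symm

theorem summable_integral_layer (u : AnisotropicW0 p Ω) (i : Fin N) :
    Summable fun k : ℕ => ∫ x in layer u (2 ^ k), |w0Grad u x i| ^ p i
      ∂volume.restrict (Ω : Set (Fin N → ℝ)) :=
  (hasSum_integral_iUnion (fun k => measurableSet_layer u (2 ^ k)) (pairwise_disjoint_layer u)
    (integrable_w0Grad_rpow u i).integrableOn).summable

theorem superlevel_anti [IsFiniteMeasure (volume.restrict (Ω : Set (Fin N → ℝ)))]
    (u : AnisotropicW0 p Ω) {s t : ℝ} (h : s ≤ t) : superlevel u t ≤ superlevel u s :=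
  measureReal_mono fun _ hx => h.trans hx

/-- One-directional Poincaré at height 2^k, raised to the power p_i, is the decay hypothesis with q
= p_i and θ = 1. -/
theorem summable_superlevel [IsFiniteMeasure (volume.restrict (Ω : Set (Fin N → ℝ)))]
    (u : AnisotropicW0 p Ω) {R : ℝ≥0} (i : Fin N) (hR : ∀ x ∈ Ω, |x i| ≤ R) :
    Summable fun k : ℕ => ((2 : ℝ) ^ k) ^ p i * superlevel u (2 ^ k) ^ (1 : ℝ) := by
  obtain ⟨L, hL1, hL⟩ := exists_deriv_ramp_le
  have hL0 : 0 ≤ L := by linarith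
  have h1 : 1 < p i := one_lt_exponent i
  have h0 : 0 < p i := by linarith
  refine summable_of_superlevel_decay (C := (2 * (R * L)) ^ p i)
    (fun k => superlevel_nonneg u _) (fun k => integral_nonneg fun x => by positivity)
    (summable_integral_layer u i) h1 one_pos (by positivity) fun k => ?_
  have hk : (0 : ℝ) < 2 ^ k := by positivity
  have h2 := mul_measureReal_le_layerIntegral u i hR hk
  have h3 := layerIntegral_le_layer u hk hL0 hL i
  set a := ∫ x in layer u (2 ^ k), |w0Grad u x i| ^ p i ∂volume.restrict (Ω : Set (Fin N → ℝ))
    with ha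
  have ha0 : 0 ≤ a := integral_nonneg fun x => by positivity
  have hM0 := superlevel_nonneg u (2 ^ k)
  have hM1 := superlevel_nonneg u (2 ^ (k + 1))
  have h4 : (2 : ℝ) ^ k * superlevel u (2 ^ (k + 1))
      ≤ 2 * (R * L) * (a ^ (1 / p i) * superlevel u (2 ^ k) ^ (1 - 1 / p i)) := by
    rw [pow_succ', superlevel]
    refine h2.trans ?_
    calc 2 * (R * layerIntegral u (2 ^ k) i) ≤ 2 * (R * (L * _)) := by gcongr
      _ = _ := by ring
  have h5 := Real.rpow_le_rpow (by positivity) h4 h0.le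
  rw [Real.mul_rpow hk.le hM1, Real.mul_rpow (x := 2 * (R * L)) (by positivity) (by positivity),
    Real.mul_rpow (x := a ^ (1 / p i)) (by positivity) (by positivity),
    ← Real.rpow_mul ha0, ← Real.rpow_mul hM0,
    one_div_mul_cancel h0.ne', Real.rpow_one, sub_mul, one_div_mul_cancel h0.ne', one_mul,
    ← mul_assoc] at h5
  rwa [sub_add_cancel]

/-- The Lorentz form, L^{P*, P}, of the anisotropic Sobolev embedding. Weighted Gagliardo–Nirenberg
at height 2^k, raised to the power P, is the decay hypothesis with q = P and θ = 1 - P/N. -/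
theorem summable_superlevel_rpow [IsFiniteMeasure (volume.restrict (Ω : Set (Fin N → ℝ)))]
    (hN : 1 < N) (hpN : harmonicMean p < N) (u : AnisotropicW0 p Ω) :
    Summable fun k : ℕ => ((2 : ℝ) ^ k) ^ harmonicMean p
      * superlevel u (2 ^ k) ^ (1 - harmonicMean p / N) := by
  obtain ⟨L, hL1, hL⟩ := exists_deriv_ramp_le
  have hL0 : 0 ≤ L := by linarith
  have hN0 : 0 < N := by omega
  have hNr : (0 : ℝ) < N := by exact_mod_cast hN0
  have hP := one_lt_harmonicMean hN0 p
  have hsum := sum_inv_exponent hN0 p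
  set P := harmonicMean p with hPdef
  have hP0 : 0 < P := by linarith
  have hθ : 0 < 1 - P / N := by
    rw [sub_pos, div_lt_one hNr]
    exact hpN
  let a : ℕ → Fin N → ℝ := fun k i =>
    ∫ x in layer u (2 ^ k), |w0Grad u x i| ^ p i ∂volume.restrict (Ω : Set (Fin N → ℝ))
  have ha0 : ∀ k i, 0 ≤ a k i := fun k i => integral_nonneg fun x => by positivity
  -- The geometric term keeps A_k positive, as the weights below require, without spoiling
  -- summability.
  let A : ℕ → ℝ := fun k => ∑ i, a k i + (1 / 2) ^ k
  have hApos : ∀ k, 0 < A k := fun k =>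
    add_pos_of_nonneg_of_pos (Finset.sum_nonneg fun i _ => ha0 k i) (by positivity)
  have haA : ∀ k i, a k i ≤ A k := fun k i =>
    (Finset.single_le_sum (fun j _ => ha0 k j) (Finset.mem_univ i)).trans
      (le_add_of_nonneg_right (by positivity))
  have hA : Summable A :=
    (summable_sum fun i _ => summable_integral_layer u i).add
      (summable_geometric_of_lt_one (by norm_num) (by norm_num))
  refine summable_of_superlevel_decay (C := (2 * (N * L)) ^ P)
    (fun k => superlevel_nonneg u _) (fun k => (hApos k).le) hA hP hθ (by positivity) fun k => ?_
  have hk : (0 : ℝ) < 2 ^ k := by positivity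
  have hexp : P - 1 + (1 - P / N) = (1 - 1 / N) * P := by ring
  have hN1 : 0 < 1 - 1 / (N : ℝ) := by
    rw [sub_pos, div_lt_one hNr]
    exact_mod_cast hN
  rw [hexp]
  have hM1 := superlevel_nonneg u (2 ^ (k + 1))
  -- The weights divide by M, so the case M = 0 is settled first; there M_{k+1} = 0 by monotonicity.
  rcases (superlevel_nonneg u (2 ^ k)).eq_or_lt with hM | hM
  · have : superlevel u (2 ^ (k + 1)) = 0 :=
      le_antisymm ((superlevel_anti u (pow_le_pow_right₀ one_le_two (Nat.le_succ k))).trans hM.ge)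
        hM1
    rw [this, Real.zero_rpow (by positivity), ← hM, Real.zero_rpow (by linarith)]
    simp
  set M := superlevel u (2 ^ k) with hMdef
  have hAk := hApos k
  -- These weights turn every A^{1/p_i} M^{1 - 1/p_i} into the common value A^{1/P} M^{1 - 1/P}.
  -- Their product is 1 because ∑ 1/p_i = N/P.
  let c : Fin N → ℝ≥0 := fun i => ⟨(A k / M) ^ (1 / P - 1 / p i), by positivity⟩
  have hc : ∏ i, c i = 1 := by
    have : ∏ i, (A k / M) ^ (1 / P - 1 / p i) = 1 := by
      rw [← Real.rpow_sum_of_pos (by positivity), Finset.sum_sub_distrib, hsum, Finset.sum_const,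
        Finset.card_univ, Fintype.card_fin, nsmul_eq_mul, mul_one_div, sub_self, Real.rpow_zero]
    apply NNReal.eq
    rw [NNReal.coe_prod]
    exact this
  have h2 := mul_measureReal_rpow_le_layerIntegral hN u c hc hk
  have h3 : ∀ i, c i * layerIntegral u (2 ^ k) i ≤ L * (A k ^ (1 / P) * M ^ (1 - 1 / P)) := by
    intro i
    have hp0 : 0 < p i := one_pos.trans (one_lt_exponent i)
    calc c i * layerIntegral u (2 ^ k) i
        ≤ c i * (L * (a k i ^ (1 / p i) * M ^ (1 - 1 / p i))) :=
          mul_le_mul_of_nonneg_left (layerIntegral_le_layer u hk hL0 hL i) (c i).2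
      _ ≤ (A k / M) ^ (1 / P - 1 / p i) * (L * (A k ^ (1 / p i) * M ^ (1 - 1 / p i))) := by
          refine mul_le_mul_of_nonneg_left ?_ (c i).2
          have := ha0 k i
          have := haA k i
          gcongr
      _ = _ := by
          rw [Real.div_rpow hAk.le hM.le, Real.rpow_sub hAk, Real.rpow_sub hM, Real.rpow_sub hM,
            Real.rpow_sub hM, Real.rpow_one]
          have := Real.rpow_pos_of_pos hM (1 / p i)
          have := Real.rpow_pos_of_pos hM (1 / P)
          have := Real.rpow_pos_of_pos hAk (1 / p i)
          field_simp
  have h4 : (2 : ℝ) ^ k * superlevel u (2 ^ (k + 1)) ^ (1 - 1 / (N : ℝ))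
      ≤ 2 * (N * L) * (A k ^ (1 / P) * M ^ (1 - 1 / P)) := by
    rw [pow_succ', superlevel]
    refine h2.trans ?_
    calc 2 * ∑ i, c i * layerIntegral u (2 ^ k) i
        ≤ 2 * ∑ _i : Fin N, L * (A k ^ (1 / P) * M ^ (1 - 1 / P)) := by
          exact mul_le_mul_of_nonneg_left (Finset.sum_le_sum fun i _ => h3 i) two_pos.le
      _ = _ := by
          rw [Finset.sum_const, Finset.card_univ, Fintype.card_fin, nsmul_eq_mul]
          ring
  have h5 := Real.rpow_le_rpow (by positivity) h4 hP0.le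
  rwa [Real.mul_rpow hk.le (by positivity), ← Real.rpow_mul hM1,
    Real.mul_rpow (x := 2 * (N * L)) (by positivity) (by positivity),
    Real.mul_rpow (x := A k ^ (1 / P)) (by positivity) (by positivity),
    ← Real.rpow_mul hAk.le, ← Real.rpow_mul hM.le,
    one_div_mul_cancel hP0.ne', Real.rpow_one,
    sub_mul 1 (1 / P) P, one_div_mul_cancel hP0.ne', one_mul, ← mul_assoc] at h5

end Space

/-! ### Integrability of the coefficients -/

/-- Each term is bounded by the sum T, so M_k ≤ T^{1/θ} 2^{-kq/θ}, and any γ < q/θ leaves a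
geometric series. -/
theorem summable_rpow_mul_of_summable {M : ℕ → ℝ} (hM : ∀ k, 0 ≤ M k) {q θ γ : ℝ} (hθ : 0 < θ)
    (hγ : γ < q / θ) (h : Summable fun k => ((2 : ℝ) ^ k) ^ q * M k ^ θ) :
    Summable fun k => ((2 : ℝ) ^ k) ^ γ * M k := by
  set T := ∑' k, ((2 : ℝ) ^ k) ^ q * M k ^ θ with hT
  have hnn : ∀ k, 0 ≤ ((2 : ℝ) ^ k) ^ q * M k ^ θ := fun k => by
    have := hM k
    positivity
  have hT0 : 0 ≤ T := tsum_nonneg hnn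
  have hgeo : Summable fun k : ℕ => T ^ (1 / θ) * ((2 : ℝ) ^ (γ - q / θ)) ^ k := by
    refine (summable_geometric_of_lt_one (by positivity) ?_).mul_left _
    exact Real.rpow_lt_one_of_one_lt_of_neg one_lt_two (by linarith)
  refine Summable.of_nonneg_of_le (fun k => ?_) (fun k => ?_) hgeo
  · have := hM k
    positivity
  have h2 : (0 : ℝ) < 2 ^ k := by positivity
  have h1 : ((2 : ℝ) ^ k) ^ q * M k ^ θ ≤ T := h.le_tsum k fun j _ => hnn j
  have h3 := Real.rpow_le_rpow (hnn k) h1 (show 0 ≤ 1 / θ by positivity)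
  rw [Real.mul_rpow (by positivity) (by have := hM k; positivity), ← Real.rpow_mul h2.le,
    ← Real.rpow_mul (hM k), mul_one_div_cancel hθ.ne', Real.rpow_one, mul_one_div] at h3
  have e : ((2 : ℝ) ^ (γ - q / θ)) ^ k = (2 ^ k) ^ γ / (2 ^ k) ^ (q / θ) := by
    rw [← Real.rpow_sub h2, ← Real.rpow_natCast, ← Real.rpow_natCast, ← Real.rpow_mul two_pos.le,
      ← Real.rpow_mul two_pos.le, mul_comm]
  rw [e, mul_div_assoc', le_div_iff₀ (by positivity)]
  calc (2 ^ k) ^ γ * M k * (2 ^ k) ^ (q / θ) = (2 ^ k) ^ γ * ((2 ^ k) ^ (q / θ) * M k) := by ring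
    _ ≤ (2 ^ k) ^ γ * T ^ (1 / θ) := by gcongr
    _ = _ := mul_comm _ _

/-- For simple g the composition is a finite sum of measurable pieces; continuity in the second
variable carries this to the limit. -/
theorem aemeasurable_caratheodory {N : ℕ} {S : Type*} [TopologicalSpace S] [PseudoMetrizableSpace S]
    [SecondCountableTopology S] [MeasurableSpace S] [OpensMeasurableSpace S] [Nonempty S]
    {Ω : Set (Fin N → ℝ)} {f : (Fin N → ℝ) → S → ℝ} (hf : IsCaratheodory Ω f)
    {g : (Fin N → ℝ) → S} (hg : StronglyMeasurable g) :
    AEMeasurable (fun x => f x (g x)) (volume.restrict Ω) := by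
  refine aemeasurable_of_tendsto_metrizable_ae atTop (f := fun n x => f x (hg.approx n x))
    (fun n => ?_) ?_
  · set h := hg.approx n
    have e : (fun x => f x (h x))
        = fun x => ∑ s ∈ h.range, (h ⁻¹' {s}).indicator (fun x => f x s) x := by
      funext x
      rw [Finset.sum_eq_single (h x)]
      · rw [indicator_of_mem (by simp)]
      · intro s _ hs
        rw [indicator_of_notMem]
        simpa using hs.symm
      · intro hx
        exact absurd (h.mem_range_self x) hx
    rw [e]
    exact Finset.aemeasurable_fun_sum _ fun s _ =>
      (hf.measurable s).indicator (h.measurableSet_fiber s)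
  · filter_upwards [hf.continuous] with x hx
    exact (hx.tendsto _).comp (hg.tendsto_approx x)

section Space

variable {N : ℕ} {p : Fin N → ℝ} {Ω : Opens (Fin N → ℝ)} [hp : ∀ i, Fact (1 < p i)]

theorem integrable_w0Fun_rpow_of_summable
    [IsFiniteMeasure (volume.restrict (Ω : Set (Fin N → ℝ)))] (u : AnisotropicW0 p Ω)
    {γ : ℝ} (hγ : 0 ≤ γ) (h : Summable fun k : ℕ => ((2 : ℝ) ^ k) ^ γ * superlevel u (2 ^ k)) :
    Integrable (fun x => |w0Fun u x| ^ γ) (volume.restrict (Ω : Set (Fin N → ℝ))) := by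
  set μ := volume.restrict (Ω : Set (Fin N → ℝ)) with hμ
  have hU := (stronglyMeasurable_w0Fun u).measurable
  refine ⟨(hU.abs.pow_const γ).aestronglyMeasurable, ?_⟩
  rw [hasFiniteIntegral_iff_ofReal (Eventually.of_forall fun x => by positivity)]
  have h1 := lintegral_mul_rpow_le_tsum (μ := μ) (w := fun _ => 1) aemeasurable_const hU hγ
  simp only [one_mul] at h1
  refine h1.trans_lt (ENNReal.add_lt_top.2 ⟨by simp, ?_⟩)
  have e : ∀ k : ℕ, ENNReal.ofReal (((2 : ℝ) ^ (k + 1)) ^ γ)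
      * ∫⁻ x in {x | (2 : ℝ) ^ k ≤ |w0Fun u x|}, 1 ∂μ
      = ENNReal.ofReal (2 ^ γ * ((2 ^ k) ^ γ * superlevel u (2 ^ k))) := by
    intro k
    rw [setLIntegral_const, one_mul, ← ofReal_measureReal, ← ENNReal.ofReal_mul (by positivity),
      pow_succ', Real.mul_rpow two_pos.le (by positivity), mul_assoc]
    rfl
  simp only [e]
  rw [← ENNReal.ofReal_tsum_of_nonneg (fun k => by have := superlevel_nonneg u (2 ^ k); positivity)
    (h.mul_left _)]
  exact ENNReal.ofReal_lt_top

/-- Below P* the exponent is reached from the Lorentz estimate, where q/θ = P / (1 - P/N) = P*;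
below some p_i, from the one-directional estimate. -/
theorem integrable_w0Fun_rpow [IsFiniteMeasure (volume.restrict (Ω : Set (Fin N → ℝ)))]
    (hN : 1 < N) (hpN : harmonicMean p < N) {R : ℝ≥0} (hR : ∀ x ∈ Ω, ∀ i, |x i| ≤ R)
    (u : AnisotropicW0 p Ω) {γ : ℝ} (hγ0 : 0 ≤ γ) (hγ : γ < pInfty p) :
    Integrable (fun x => |w0Fun u x| ^ γ) (volume.restrict (Ω : Set (Fin N → ℝ))) := by
  refine integrable_w0Fun_rpow_of_summable u hγ0 ?_
  have hN0 : 0 < N := by omega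
  have hNr : (0 : ℝ) < N := by exact_mod_cast hN0
  have : Nonempty (Fin N) := ⟨⟨0, hN0⟩⟩
  rcases lt_max_iff.1 hγ with h | h
  · refine summable_rpow_mul_of_summable (fun k => superlevel_nonneg u _) ?_ ?_
      (summable_superlevel_rpow hN hpN u)
    · rw [sub_pos, div_lt_one hNr]
      exact hpN
    · convert! h using 1
      rw [sobolevExponent]
      have : (N : ℝ) - harmonicMean p ≠ 0 := by linarith
      field_simp
  · obtain ⟨i, hi⟩ := exists_lt_of_lt_ciSup h
    exact summable_rpow_mul_of_summable (fun k => superlevel_nonneg u _) one_pos (by simpa using hi)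
      (summable_superlevel u i fun x hx => hR x hx i)

/-- b^{p_i'} lies in weak L^{N/P} with N/P > 1, and the exponent 1 - P/N is exactly the one in
`summable_superlevel_rpow`. -/
theorem exists_setLIntegral_rpow_conj_le [IsFiniteMeasure (volume.restrict (Ω : Set (Fin N → ℝ)))]
    (hN : 0 < N) (hpN : harmonicMean p < N) {b : (Fin N → ℝ) → ℝ} (hb0 : ∀ x ∈ Ω, 0 ≤ b x)
    (i : Fin N)
    (hb : MemMarcinkiewicz (Ω : Set (Fin N → ℝ)) (N * conj (p i) / harmonicMean p) b) :
    ∃ C : ℝ, 0 ≤ C ∧ ∀ E : Set (Fin N → ℝ),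
      ∫⁻ x in E, ENNReal.ofReal (b x ^ conj (p i)) ∂volume.restrict (Ω : Set (Fin N → ℝ))
        ≤ ENNReal.ofReal
          (C * (volume.restrict (Ω : Set (Fin N → ℝ))).real E ^ (1 - harmonicMean p / N)) := by
  have hNr : (0 : ℝ) < N := by exact_mod_cast hN
  have hP := one_lt_harmonicMean hN p
  have hc : 0 < conj (p i) := (conj_holderConjugate i).symm.pos
  obtain ⟨hbm, C, hC⟩ := hb
  have hbΩ : ∀ᵐ x ∂volume.restrict (Ω : Set (Fin N → ℝ)), 0 ≤ b x := by
    filter_upwards [ae_restrict_mem Ω.isOpen.measurableSet] with x hx using hb0 x hx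
  have h := exists_setLIntegral_le_of_weak (μ := volume.restrict (Ω : Set (Fin N → ℝ)))
    (w := fun x => b x ^ conj (p i)) (r := N / harmonicMean p) (C := C)
    (by filter_upwards [hbΩ] with x hx; exact Real.rpow_nonneg hx _) (hbm.pow_const _)
    (by rwa [one_lt_div (by linarith)]) ?_
  · simpa only [one_div_div] using h
  · intro t ht
    have ht' : 0 < t ^ (1 / conj (p i)) := by positivity
    refine le_trans ?_ (hC _ ht')
    rw [← Real.rpow_mul ht.le, Measure.restrict_apply' Ω.isOpen.measurableSet]
    have e : 1 / conj (p i) * (N * conj (p i) / harmonicMean p) = N / harmonicMean p := by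
      field_simp
    rw [e]
    refine mul_le_mul_right (measure_mono ?_) _
    rintro x ⟨hx, hxΩ⟩
    refine ⟨hxΩ, ?_⟩
    rw [abs_of_nonneg (hb0 x hxΩ)]
    have h2 := Real.rpow_lt_rpow ht.le hx (show 0 < 1 / conj (p i) by positivity)
    rwa [← Real.rpow_mul (hb0 x hxΩ), mul_one_div_cancel hc.ne', Real.rpow_one] at h2

/-- Dyadic decomposition in |u|: the k-th piece of the second integral is at most a constant times
2^{kP} |{|u| ≥ 2^k}|^{1 - P/N}, which is summable. -/
theorem integrable_rpow_conj_and_mul [IsFiniteMeasure (volume.restrict (Ω : Set (Fin N → ℝ)))]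
    (hN : 1 < N) (hpN : harmonicMean p < N) {b : (Fin N → ℝ) → ℝ} (hb0 : ∀ x ∈ Ω, 0 ≤ b x)
    (i : Fin N)
    (hb : MemMarcinkiewicz (Ω : Set (Fin N → ℝ)) (N * conj (p i) / harmonicMean p) b)
    (u : AnisotropicW0 p Ω) :
    Integrable (fun x => b x ^ conj (p i)) (volume.restrict (Ω : Set (Fin N → ℝ))) ∧
      Integrable (fun x => b x ^ conj (p i) * |w0Fun u x| ^ harmonicMean p)
        (volume.restrict (Ω : Set (Fin N → ℝ))) := by
  have hN0 : 0 < N := by omega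
  have hP := one_lt_harmonicMean hN0 p
  obtain ⟨C, hC0, hC⟩ := exists_setLIntegral_rpow_conj_le hN0 hpN hb0 i hb
  set μ := volume.restrict (Ω : Set (Fin N → ℝ)) with hμ
  have hU := (stronglyMeasurable_w0Fun u).measurable
  have hbΩ : ∀ᵐ x ∂μ, 0 ≤ b x := by
    filter_upwards [ae_restrict_mem Ω.isOpen.measurableSet] with x hx using hb0 x hx
  have hm : AEMeasurable (fun x => b x ^ conj (p i)) μ := hb.1.pow_const _
  have hfin : ∫⁻ x, ENNReal.ofReal (b x ^ conj (p i)) ∂μ < ⊤ := by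
    rw [← setLIntegral_univ]
    exact (hC univ).trans_lt ENNReal.ofReal_lt_top
  refine ⟨⟨hm.aestronglyMeasurable, ?_⟩,
    ⟨(hm.mul (hU.abs.pow_const _).aemeasurable).aestronglyMeasurable, ?_⟩⟩
  · rwa [hasFiniteIntegral_iff_ofReal (by
      filter_upwards [hbΩ] with x hx; exact Real.rpow_nonneg hx _)]
  rw [hasFiniteIntegral_iff_ofReal (by
    filter_upwards [hbΩ] with x hx
    exact mul_nonneg (Real.rpow_nonneg hx _) (by positivity))]
  have e0 : ∫⁻ x, ENNReal.ofReal (b x ^ conj (p i) * |w0Fun u x| ^ harmonicMean p) ∂μ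
      = ∫⁻ x, ENNReal.ofReal (b x ^ conj (p i))
        * ENNReal.ofReal (|w0Fun u x| ^ harmonicMean p) ∂μ := by
    refine lintegral_congr_ae ?_
    filter_upwards [hbΩ] with x hx
    exact ENNReal.ofReal_mul (Real.rpow_nonneg hx _)
  rw [e0]
  refine (lintegral_mul_rpow_le_tsum hm.ennreal_ofReal hU (by linarith)).trans_lt
    (ENNReal.add_lt_top.2 ⟨hfin, ?_⟩)
  have hsum := (summable_superlevel_rpow hN hpN u).mul_left (2 ^ harmonicMean p * C)
  have hnn : ∀ k : ℕ, 0 ≤ 2 ^ harmonicMean p * C * (((2 : ℝ) ^ k) ^ harmonicMean p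
      * superlevel u (2 ^ k) ^ (1 - harmonicMean p / N)) := fun k => by
    have := superlevel_nonneg u (2 ^ k)
    positivity
  refine lt_of_le_of_lt (ENNReal.tsum_le_tsum fun k => ?_)
    ((ENNReal.ofReal_tsum_of_nonneg hnn hsum).symm.trans_lt ENNReal.ofReal_lt_top)
  refine (mul_le_mul_right (hC _) _).trans (le_of_eq ?_)
  rw [← ENNReal.ofReal_mul (by positivity), pow_succ', Real.mul_rpow two_pos.le (by positivity)]
  congr 1
  change _ * (C * superlevel u (2 ^ k) ^ (1 - harmonicMean p / N)) = _
  ring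

end Space

/-! ### The energy estimate and uniqueness -/

/-- The small factor δ allows the convection term to be absorbed by coercivity. -/
theorem exists_young {r s : ℝ} (hrs : r.HolderConjugate s) {δ : ℝ} (hδ : 0 < δ) :
    ∃ K : ℝ, 0 ≤ K ∧ ∀ a b : ℝ, 0 ≤ a → 0 ≤ b → a * b ≤ δ * a ^ r + K * b ^ s := by
  let t : ℝ := δ ^ (1 / r)
  have ht : 0 < t := by positivity
  have htr : t ^ r = δ := by
    rw [← Real.rpow_mul hδ.le, one_div_mul_cancel hrs.ne_zero, Real.rpow_one]
  refine ⟨(t ^ s)⁻¹, by positivity, fun a b ha hb => ?_⟩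
  have h := Real.young_inequality_of_nonneg (mul_nonneg ht.le ha) (div_nonneg hb ht.le) hrs
  rw [Real.mul_rpow ht.le ha, Real.div_rpow hb ht.le, htr] at h
  have e : t * a * (b / t) = a * b := by field_simp
  rw [e] at h
  refine h.trans (add_le_add (div_le_self (by positivity) hrs.lt.le) ?_)
  refine (div_le_self (by positivity) hrs.symm.lt.le).trans (le_of_eq ?_)
  rw [div_eq_inv_mul]

theorem memLp_of_rpow_abs_le {X : Type*} [MeasurableSpace X] {μ : Measure X} {f g : X → ℝ} {s : ℝ}
    (hs : 0 < s) (hf : AEMeasurable f μ) (hg : Integrable g μ) (h : ∀ᵐ x ∂μ, |f x| ^ s ≤ g x) :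
    MemLp f (ENNReal.ofReal s) μ := by
  rw [← integrable_norm_rpow_iff hf.aestronglyMeasurable (by simpa using hs) ENNReal.ofReal_ne_top,
    ENNReal.toReal_ofReal hs.le]
  refine hg.mono' (hf.norm.pow_const s).aestronglyMeasurable ?_
  filter_upwards [h] with x hx
  rwa [Real.norm_of_nonneg (by positivity)]

theorem exists_abs_le_of_isBounded {N : ℕ} {s : Set (Fin N → ℝ)} (hs : Bornology.IsBounded s) :
    ∃ R : ℝ≥0, ∀ x ∈ s, ∀ i, |x i| ≤ R := by
  obtain ⟨R, hR⟩ := hs.exists_norm_le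
  refine ⟨R.toNNReal, fun x hx i => ?_⟩
  rw [← Real.norm_eq_abs]
  exact (norm_le_pi_norm x i).trans ((hR x hx).trans (Real.le_coe_toNNReal R))

section Space

variable {N : ℕ} {p : Fin N → ℝ} {Ω : Opens (Fin N → ℝ)} [hp : ∀ i, Fact (1 < p i)]

/-- A weak equation may be tested with smooth bounded functions of the solution. -/
theorem weak_equation_comp (u : AnisotropicW0 p Ω) {V : Fin N → (Fin N → ℝ) → ℝ}
    {g : (Fin N → ℝ) → ℝ}
    (hV : ∀ i, MemLp (V i) (ENNReal.ofReal (conj (p i)))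
      (volume.restrict (Ω : Set (Fin N → ℝ))))
    (hg : Integrable g (volume.restrict (Ω : Set (Fin N → ℝ))))
    (h : ∀ ψ : 𝓓(Ω, ℝ), ∫ x in (Ω : Set (Fin N → ℝ)),
      ((∑ i, V i x * partialDeriv i ψ x) + g x * ψ x) = 0)
    {f : ℝ → ℝ} (hf : ContDiff ℝ ∞ f) (hf0 : f 0 = 0) {L L' : ℝ} (hL : ∀ y, |deriv f y| ≤ L)
    (hL' : ∀ y, |f y| ≤ L') :
    (∑ i, ∫ x in (Ω : Set (Fin N → ℝ)), V i x * (deriv f (w0Fun u x) * w0Grad u x i))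
      + ∫ x in (Ω : Set (Fin N → ℝ)), g x * f (w0Fun u x) = 0 := by
  set μ := volume.restrict (Ω : Set (Fin N → ℝ)) with hμ
  obtain ⟨φ, hφ, hgrad⟩ := exists_seq_testFunction u
  have hf' : Continuous (deriv f) := hf.continuous_deriv (by simp)
  have hconj : ∀ i, (ENNReal.ofReal (p i)).HolderConjugate (ENNReal.ofReal (conj (p i))) :=
    fun i => (conj_holderConjugate i).ennrealOfReal
  have h1 : ∀ i, Tendsto
      (fun n => ∫ x, V i x * (deriv f (φ n x) * partialDeriv i (φ n) x) ∂μ) atTop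
      (𝓝 (∫ x, V i x * (deriv f (w0Fun u x) * w0Grad u x i) ∂μ)) := by
    intro i
    have := hconj i
    refine tendsto_integral_mul_mul (hV i) (memLp_w0Grad u i)
      (fun n => memLp_partialDeriv (φ n) i _)
      (fun n => (hf'.comp (φ n).continuous).aestronglyMeasurable) (fun n x => hL _) ?_ (hgrad i)
    filter_upwards [hφ] with x hx using (hf'.tendsto _).comp hx
  -- `g` is only integrable, so the boundedness of f provides the dominating function.
  have h2 : Tendsto (fun n => ∫ x, g x * f (φ n x) ∂μ) atTop
      (𝓝 (∫ x, g x * f (w0Fun u x) ∂μ)) := by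
    refine tendsto_integral_of_dominated_convergence (fun x => L' * |g x|)
      (fun n => hg.aestronglyMeasurable.mul
        (hf.continuous.comp (φ n).continuous).aestronglyMeasurable)
      (hg.abs.const_mul L') (fun n => Eventually.of_forall fun x => ?_) ?_
    · rw [norm_mul, mul_comm]
      exact mul_le_mul_of_nonneg_right (hL' _) (abs_nonneg _)
    · filter_upwards [hφ] with x hx
      exact ((hf.continuous.tendsto _).comp hx).const_mul _
  refine tendsto_nhds_unique ((tendsto_finsetSum _ fun i _ => h1 i).add h2)
    (tendsto_const_nhds.congr fun n => ?_)
  have h3 := h (compTest f hf hf0 (φ n))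
  have hint : ∀ i, Integrable
      (fun x => V i x * partialDeriv i (compTest f hf hf0 (φ n)) x) μ := by
    intro i
    have := (hconj i).symm
    exact (hV i).integrable_mul
      (memLp_partialDeriv (compTest f hf hf0 (φ n)) i (ENNReal.ofReal (p i)))
  rw [integral_add (integrable_finsetSum _ fun i _ => hint i), integral_finsetSum _
    fun i _ => hint i] at h3
  · simp only [partialDeriv_compTest, compTest_apply] at h3
    exact h3.symm
  · refine hg.mul_bdd (c := L') (hf.continuous.comp (φ n).continuous).aestronglyMeasurable
      (Eventually.of_forall fun x => hL' _)

theorem memLp_principal {α : ℝ} {β : Fin N → ℝ} {A : Fin N → (Fin N → ℝ) → (Fin N → ℝ) → ℝ}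
    (hA : PrincipalPart p Ω α β A) (u : AnisotropicW0 p Ω) (i : Fin N) :
    MemLp (fun x => A i x (w0Grad u x)) (ENNReal.ofReal (conj (p i)))
      (volume.restrict (Ω : Set (Fin N → ℝ))) := by
  have hc := conj_holderConjugate (p := p) i
  have hβ : 0 ≤ β i := hA.alpha_pos.le.trans (hA.alpha_le i)
  refine memLp_of_rpow_abs_le hc.symm.pos
    (aemeasurable_caratheodory (hA.caratheodory i) (measurable_w0Grad u).stronglyMeasurable)
    ((integrable_w0Grad_rpow u i).const_mul (β i ^ conj (p i))) ?_
  filter_upwards [hA.growth i] with x hx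
  refine (Real.rpow_le_rpow (abs_nonneg _) (hx _) hc.symm.nonneg).trans (le_of_eq ?_)
  rw [Real.mul_rpow hβ (by positivity), ← Real.rpow_mul (abs_nonneg _), hc.sub_one_mul_conj]

theorem rpow_abs_convection_le {b : Fin N → (Fin N → ℝ) → ℝ} {B : Fin N → (Fin N → ℝ) → ℝ → ℝ}
    (hB : ConvectionTerm p Ω b B) (i : Fin N) :
    ∀ᵐ x ∂volume.restrict (Ω : Set (Fin N → ℝ)), ∀ s : ℝ,
      |B i x s| ^ conj (p i) ≤ b i x ^ conj (p i) * |s| ^ harmonicMean p := by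
  have hc := conj_holderConjugate (p := p) i
  filter_upwards [hB.growth i, ae_restrict_mem Ω.isOpen.measurableSet] with x hx hxΩ s
  refine (Real.rpow_le_rpow (abs_nonneg _) (hx s) hc.symm.nonneg).trans (le_of_eq ?_)
  rw [Real.mul_rpow (hB.nonneg i x hxΩ) (by positivity), ← Real.rpow_mul (abs_nonneg _),
    div_mul_cancel₀ _ hc.symm.ne_zero]

theorem memLp_convection [IsFiniteMeasure (volume.restrict (Ω : Set (Fin N → ℝ)))]
    (hN : 1 < N) (hpN : harmonicMean p < N)
    {b : Fin N → (Fin N → ℝ) → ℝ} {B : Fin N → (Fin N → ℝ) → ℝ → ℝ}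
    (hB : ConvectionTerm p Ω b B) (u : AnisotropicW0 p Ω) (i : Fin N) :
    MemLp (fun x => B i x (w0Fun u x)) (ENNReal.ofReal (conj (p i)))
      (volume.restrict (Ω : Set (Fin N → ℝ))) := by
  refine memLp_of_rpow_abs_le (conj_holderConjugate i).symm.pos
    (aemeasurable_caratheodory (hB.caratheodory i) (stronglyMeasurable_w0Fun u))
    (integrable_rpow_conj_and_mul hN hpN (hB.nonneg i) i (hB.marcinkiewicz i) u).2 ?_
  filter_upwards [rpow_abs_convection_le hB i] with x hx using hx _

theorem integrable_zeroOrder [IsFiniteMeasure (volume.restrict (Ω : Set (Fin N → ℝ)))]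
    (hN : 1 < N) (hpN : harmonicMean p < N) {R : ℝ≥0} (hR : ∀ x ∈ Ω, ∀ i, |x i| ≤ R)
    {μ γ : ℝ} {G : (Fin N → ℝ) → ℝ → ℝ} (hG : ZeroOrderTerm p Ω μ γ G) (u : AnisotropicW0 p Ω) :
    Integrable (fun x => G x (w0Fun u x)) (volume.restrict (Ω : Set (Fin N → ℝ))) := by
  have h1 := hG.one_le_gamma
  have h2 := hG.gamma_lt
  refine ((integrable_w0Fun_rpow hN hpN hR u (γ := γ) (by linarith) (by linarith)).const_mul μ).mono'
    (aemeasurable_caratheodory hG.caratheodory (stronglyMeasurable_w0Fun u)).aestronglyMeasurable ?_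
  filter_upwards [hG.growth] with x hx using hx _

/-- The energy of a solution in the layer `ε < |u| < 2 ε` is controlled by the coefficients
of the first order term on the layer. -/
theorem exists_layerEnergy_le [IsFiniteMeasure (volume.restrict (Ω : Set (Fin N → ℝ)))]
    (hN : 1 < N) (hpN : harmonicMean p < N)
    {α : ℝ} {β : Fin N → ℝ} {A : Fin N → (Fin N → ℝ) → (Fin N → ℝ) → ℝ}
    (hA : PrincipalPart p Ω α β A)
    {b : Fin N → (Fin N → ℝ) → ℝ} {B : Fin N → (Fin N → ℝ) → ℝ → ℝ}
    (hB : ConvectionTerm p Ω b B) (u : AnisotropicW0 p Ω) {g : (Fin N → ℝ) → ℝ}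
    (hg : Integrable g (volume.restrict (Ω : Set (Fin N → ℝ))))
    (hg0 : ∀ᵐ x ∂volume.restrict (Ω : Set (Fin N → ℝ)), 0 ≤ g x * w0Fun u x)
    (h : ∀ ψ : 𝓓(Ω, ℝ), ∫ x in (Ω : Set (Fin N → ℝ)),
      ((∑ i, (A i x (w0Grad u x) + B i x (w0Fun u x)) * partialDeriv i ψ x) + g x * ψ x) = 0) :
    ∃ K : Fin N → ℝ, (∀ i, 0 ≤ K i) ∧ ∀ ε : ℝ, 0 < ε → ∀ j,
      layerEnergy u ε j ≤ ε ^ harmonicMean p * ∑ i, K i *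
        ∫ x in layer u ε, b i x ^ conj (p i) ∂volume.restrict (Ω : Set (Fin N → ℝ)) := by
  set μ := volume.restrict (Ω : Set (Fin N → ℝ)) with hμ
  have hα := hA.alpha_pos
  have hP := one_lt_harmonicMean (p := p) (by omega : 0 < N)
  obtain ⟨L, hL1, hL⟩ := exists_deriv_ramp_le
  choose K hK0 hK using fun i => exists_young (conj_holderConjugate (p := p) i) (half_pos hα)
  have hbint := fun i => integrable_rpow_conj_and_mul hN hpN (hB.nonneg i) i (hB.marcinkiewicz i) u
  have hbΩ : ∀ i, ∀ᵐ x ∂μ, 0 ≤ b i x := fun i => by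
    filter_upwards [ae_restrict_mem Ω.isOpen.measurableSet] with x hx using hB.nonneg i x hx
  -- The factor 2/α undoes the half of coercivity left after Young's inequality, L bounds the
  -- weight, and 2^P comes from |u| < 2ε on the layer.
  refine ⟨fun i => 2 / α * (K i * (L * 2 ^ harmonicMean p)), fun i => by
    have := hK0 i
    positivity, fun ε hε j => ?_⟩
  let V : Fin N → (Fin N → ℝ) → ℝ := fun i x => A i x (w0Grad u x) + B i x (w0Fun u x)
  have hV : ∀ i, MemLp (V i) (ENNReal.ofReal (conj (p i))) μ := fun i =>
    (memLp_principal hA u i).add (memLp_convection hN hpN hB u i)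
  have hVint : ∀ i, Integrable (fun x => V i x * w0Grad u x i) μ := fun i => by
    have := (conj_holderConjugate (p := p) i).symm.ennrealOfReal
    exact (hV i).integrable_mul (memLp_w0Grad u i)
  have htest := weak_equation_comp u hV hg h (contDiff_ramp_div ε)
    (by simp [ramp_zero]) (L := L / ε) (L' := 1) (fun y => by
      rw [deriv_ramp_div, abs_of_nonneg (div_nonneg (deriv_ramp_nonneg _) hε.le)]
      exact div_le_div_of_nonneg_right (hL _) hε.le) (fun y => abs_ramp_le_one _)
  have hgnn : 0 ≤ ∫ x, g x * ramp (w0Fun u x / ε) ∂μ := by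
    refine integral_nonneg_of_ae ?_
    filter_upwards [hg0] with x hx using mul_ramp_nonneg ε hε hx
  -- The tested equation multiplied by ε, with the nonnegative zero order term discarded.
  have hsum : ∑ i, ∫ x, deriv ramp (w0Fun u x / ε) * (V i x * w0Grad u x i) ∂μ ≤ 0 := by
    have e : ∀ i, ∫ x, deriv ramp (w0Fun u x / ε) * (V i x * w0Grad u x i) ∂μ
        = ε * ∫ x, V i x * (deriv (fun y => ramp (y / ε)) (w0Fun u x) * w0Grad u x i) ∂μ := by
      intro i
      rw [← integral_const_mul]
      refine integral_congr_ae (Eventually.of_forall fun x => ?_)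
      simp only [deriv_ramp_div]
      field_simp
    simp only [e]
    rw [← Finset.mul_sum]
    exact mul_nonpos_of_nonneg_of_nonpos hε.le (by linarith)
  have hpt : ∀ i, α / 2 * layerEnergy u ε i
      - K i * ∫ x, deriv ramp (w0Fun u x / ε) *
        (b i x ^ conj (p i) * |w0Fun u x| ^ harmonicMean p) ∂μ
      ≤ ∫ x, deriv ramp (w0Fun u x / ε) * (V i x * w0Grad u x i) ∂μ := by
    intro i
    rw [layerEnergy, ← integral_const_mul, ← integral_const_mul, ← integral_sub
      ((integrable_deriv_ramp_mul u ε (integrable_w0Grad_rpow u i)).const_mul _)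
      ((integrable_deriv_ramp_mul u ε (hbint i).2).const_mul _)]
    refine integral_mono_ae
      (((integrable_deriv_ramp_mul u ε (integrable_w0Grad_rpow u i)).const_mul _).sub
      ((integrable_deriv_ramp_mul u ε (hbint i).2).const_mul _))
      (integrable_deriv_ramp_mul u ε (hVint i)) ?_
    filter_upwards [hA.coercive i, rpow_abs_convection_le hB i] with x hx1 hx2
    have h1 := hx1 (w0Grad u x)
    have h2 := hx2 (w0Fun u x)
    have h3 := hK i |w0Grad u x i| |B i x (w0Fun u x)| (abs_nonneg _) (abs_nonneg _)
    have h4 : -(|w0Grad u x i| * |B i x (w0Fun u x)|) ≤ B i x (w0Fun u x) * w0Grad u x i := by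
      rw [mul_comm |w0Grad u x i|, ← abs_mul]
      exact neg_abs_le _
    have h5 := mul_le_mul_of_nonneg_left h2 (hK0 i)
    have h6 : α / 2 * |w0Grad u x i| ^ p i
        - K i * (b i x ^ conj (p i) * |w0Fun u x| ^ harmonicMean p)
        ≤ V i x * w0Grad u x i := by
      simp only [V]
      rw [add_mul]
      linarith
    have h7 := mul_le_mul_of_nonneg_left h6 (deriv_ramp_nonneg (w0Fun u x / ε))
    refine le_trans (le_of_eq ?_) h7
    ring
  have hlayer : ∀ i, ∫ x, deriv ramp (w0Fun u x / ε) *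
        (b i x ^ conj (p i) * |w0Fun u x| ^ harmonicMean p) ∂μ
      ≤ L * ((2 * ε) ^ harmonicMean p * ∫ x in layer u ε, b i x ^ conj (p i) ∂μ) := by
    intro i
    refine (integral_deriv_ramp_mul_le hε hL (hbint i).2 ?_).trans
      (mul_le_mul_of_nonneg_left ?_ (by linarith))
    · filter_upwards [hbΩ i] with x hx
      exact mul_nonneg (Real.rpow_nonneg hx _) (by positivity)
    · rw [← integral_const_mul]
      refine integral_mono_ae (hbint i).2.restrict ((hbint i).1.restrict.const_mul _) ?_
      filter_upwards [ae_restrict_of_ae (hbΩ i), ae_restrict_mem (measurableSet_layer u ε)]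
        with x hx hxl
      rw [mul_comm]
      exact mul_le_mul_of_nonneg_right
        (Real.rpow_le_rpow (abs_nonneg _) hxl.2.le (by linarith)) (Real.rpow_nonneg hx _)
  have h8 : α / 2 * ∑ i, layerEnergy u ε i
      ≤ ∑ i, K i * (L * ((2 * ε) ^ harmonicMean p * ∫ x in layer u ε, b i x ^ conj (p i) ∂μ)) := by
    have h9 := (Finset.sum_le_sum fun i (_ : i ∈ Finset.univ) => hpt i).trans hsum
    rw [Finset.sum_sub_distrib, ← Finset.mul_sum] at h9
    have h10 := Finset.sum_le_sum fun i (_ : i ∈ Finset.univ) =>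
      mul_le_mul_of_nonneg_left (hlayer i) (hK0 i)
    linarith
  have h11 : layerEnergy u ε j ≤ ∑ i, layerEnergy u ε i :=
    Finset.single_le_sum (fun i _ => layerEnergy_nonneg u ε i) (Finset.mem_univ j)
  calc layerEnergy u ε j ≤ 2 / α * (α / 2 * ∑ i, layerEnergy u ε i) := by
        rw [← mul_assoc, div_mul_div_cancel₀ hα.ne', div_self two_ne_zero, one_mul]
        exact h11
    _ ≤ 2 / α * _ := mul_le_mul_of_nonneg_left h8 (by positivity)
    _ = _ := by
        rw [Real.mul_rpow two_pos.le hε.le, Finset.mul_sum, Finset.mul_sum]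
        refine Finset.sum_congr rfl fun i _ => ?_
        ring

/-- A point with u = 0 lies in no layer, and any other point leaves the layers once 2ε < |u|;
dominated convergence applies. -/
theorem tendsto_setIntegral_layer (u : AnisotropicW0 p Ω) {w : (Fin N → ℝ) → ℝ}
    (hw : Integrable w (volume.restrict (Ω : Set (Fin N → ℝ)))) {ε : ℕ → ℝ} (hε : ∀ k, 0 < ε k)
    (hlim : Tendsto ε atTop (𝓝 0)) :
    Tendsto (fun k => ∫ x in layer u (ε k), w x ∂volume.restrict (Ω : Set (Fin N → ℝ))) atTop
      (𝓝 0) := by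
  simp_rw [← integral_indicator (measurableSet_layer u _)]
  have := tendsto_integral_of_dominated_convergence (μ := volume.restrict (Ω : Set (Fin N → ℝ)))
    (F := fun k => (layer u (ε k)).indicator w) (f := fun _ => 0) (fun x => |w x|)
    (fun k => hw.aestronglyMeasurable.indicator (measurableSet_layer u _)) hw.abs
    (fun k => Eventually.of_forall fun x => norm_indicator_le_norm_self w x) ?_
  · simpa using this
  · refine Eventually.of_forall fun x => ?_
    refine tendsto_const_nhds.congr' ?_
    rcases eq_or_ne (w0Fun u x) 0 with h0 | h0
    · refine Eventually.of_forall fun k => (indicator_of_notMem (fun hx => ?_) _).symm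
      have := hx.1
      rw [h0, abs_zero] at this
      linarith [hε k]
    · filter_upwards [hlim.eventually_lt_const (half_pos (abs_pos.2 h0))] with k hk
      refine (indicator_of_notMem (fun hx => ?_) _).symm
      linarith [hx.2]

/-- Poincaré's inequality loses a factor 1/ε, which the energy bound compensates exactly because p_j
≤ P; what remains tends to 0 with η. -/
theorem ae_eq_zero_of_layerEnergy_le [IsFiniteMeasure (volume.restrict (Ω : Set (Fin N → ℝ)))]
    {R : ℝ≥0} (hR : ∀ x ∈ Ω, ∀ i, |x i| ≤ R) (u : AnisotropicW0 p Ω) (j : Fin N) {P : ℝ}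
    (hj : p j ≤ P) {η : ℕ → ℝ} (hη0 : ∀ k, 0 ≤ η k) (hη : Tendsto η atTop (𝓝 0))
    (h : ∀ k : ℕ, layerEnergy u ((1 / 2) ^ k) j ≤ ((1 / 2 : ℝ) ^ k) ^ P * η k) :
    ∀ᵐ x ∂volume.restrict (Ω : Set (Fin N → ℝ)), w0Fun u x = 0 := by
  set μ := volume.restrict (Ω : Set (Fin N → ℝ)) with hμ
  have hp1 : 1 < p j := one_lt_exponent j
  have hp0 : 0 < p j := by linarith
  have h1p : 0 ≤ 1 - 1 / p j := by
    rw [sub_nonneg, div_le_one hp0]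
    exact hp1.le
  obtain ⟨L, hL1, hL⟩ := exists_deriv_ramp_le
  set Λ : ℝ := (L * μ.real univ) ^ (1 - 1 / p j) with hΛ
  have hΛ0 : 0 ≤ Λ := Real.rpow_nonneg (mul_nonneg (by linarith) measureReal_nonneg) _
  have hσ : ∀ ε : ℝ, (∫ x, deriv ramp (w0Fun u x / ε) ∂μ) ^ (1 - 1 / p j) ≤ Λ := by
    intro ε
    refine Real.rpow_le_rpow (integral_nonneg fun x => deriv_ramp_nonneg _) ?_ h1p
    have hint : Integrable (fun x => deriv ramp (w0Fun u x / ε)) μ := by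
      simpa using integrable_deriv_ramp_mul u ε (integrable_const (μ := μ) (1 : ℝ))
    refine (integral_mono hint (integrable_const L) fun x => hL _).trans (le_of_eq ?_)
    rw [integral_const, smul_eq_mul, mul_comm]
  have hbound : ∀ k : ℕ, superlevel u (2 * (1 / 2) ^ k) ≤ 2 * (R * (η k ^ (1 / p j) * Λ)) := by
    intro k
    set ε : ℝ := (1 / 2) ^ k with hε
    have hε0 : 0 < ε := by positivity
    have hε1 : ε ≤ 1 := pow_le_one₀ (by norm_num) (by norm_num)
    -- Here P / p_j ≥ 1 and ε ≤ 1 give ε^{P / p_j} ≤ ε.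
    have hE : layerEnergy u ε j ^ (1 / p j) ≤ ε * η k ^ (1 / p j) := by
      refine (Real.rpow_le_rpow (layerEnergy_nonneg u ε j) (h k) (by positivity)).trans ?_
      rw [Real.mul_rpow (by positivity) (hη0 k), ← Real.rpow_mul hε0.le]
      refine mul_le_mul_of_nonneg_right ?_ (Real.rpow_nonneg (hη0 k) _)
      calc ε ^ (P * (1 / p j)) ≤ ε ^ (1 : ℝ) :=
            Real.rpow_le_rpow_of_exponent_ge hε0 hε1 (by rwa [mul_one_div, one_le_div hp0])
        _ = ε := Real.rpow_one ε
    have hJ : layerIntegral u ε j ≤ ε * η k ^ (1 / p j) * Λ :=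
      (layerIntegral_le u ε j).trans (mul_le_mul hE (hσ ε)
        (Real.rpow_nonneg (integral_nonneg fun x => deriv_ramp_nonneg _) _)
        (mul_nonneg hε0.le (Real.rpow_nonneg (hη0 k) _)))
    have h2 := mul_measureReal_le_layerIntegral u j (fun x hx => hR x hx j) hε0
    refine le_of_mul_le_mul_left ?_ hε0
    calc ε * superlevel u (2 * ε) ≤ 2 * (R * layerIntegral u ε j) := h2
      _ ≤ 2 * (R * (ε * η k ^ (1 / p j) * Λ)) := by gcongr
      _ = _ := by ring
  have hlim : Tendsto (fun k : ℕ => 2 * (R * (η k ^ (1 / p j) * Λ))) atTop (𝓝 0) := by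
    have h3 : Tendsto (fun k => η k ^ (1 / p j)) atTop (𝓝 0) := by
      have := hη.rpow_const (p := 1 / p j) (Or.inr (by positivity))
      rwa [Real.zero_rpow (by positivity)] at this
    simpa using ((h3.mul_const Λ).const_mul (R : ℝ)).const_mul 2
  have hzero : ∀ m : ℕ, μ {x | 2 * (1 / 2) ^ m ≤ |w0Fun u x|} = 0 := by
    intro m
    -- For k ≥ m the threshold is lower and the superlevel set larger, so the fixed set at m obeys
    -- every later bound.
    have h4 : superlevel u (2 * (1 / 2) ^ m) ≤ 0 := by
      refine ge_of_tendsto hlim ?_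
      filter_upwards [eventually_ge_atTop m] with k hk
      refine (superlevel_anti u ?_).trans (hbound k)
      exact mul_le_mul_of_nonneg_left (pow_le_pow_of_le_one (by norm_num) (by norm_num) hk)
        two_pos.le
    exact (measureReal_eq_zero_iff).1 (le_antisymm h4 (superlevel_nonneg u _))
  filter_upwards [ae_all_iff.2 fun m => measure_eq_zero_iff_ae_notMem.1 (hzero m)] with x hx
  by_contra h0
  obtain ⟨m, hm⟩ := exists_pow_lt_of_lt_one (half_pos (abs_pos.2 h0))
    (by norm_num : (1 / 2 : ℝ) < 1)
  refine hx m ?_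
  linarith

end Space

end Anisotropic

open Anisotropic Filter Topology in
theorem mainTheorem8 {N : ℕ} (hN : 2 < N) (p : Fin N → ℝ) [hp : ∀ i, Fact (1 < p i)]
    (hpN : Anisotropic.harmonicMean p < N)
    (Ω : Opens (Fin N → ℝ)) (hΩ : Bornology.IsBounded (Ω : Set (Fin N → ℝ)))
    (α : ℝ) (β : Fin N → ℝ) (A : Fin N → (Fin N → ℝ) → (Fin N → ℝ) → ℝ)
    (hA : Anisotropic.PrincipalPart p Ω α β A)
    (b : Fin N → (Fin N → ℝ) → ℝ) (B : Fin N → (Fin N → ℝ) → ℝ → ℝ)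
    (hB : Anisotropic.ConvectionTerm p Ω b B)
    (G : (Fin N → ℝ) → ℝ → ℝ)
    (hG : (∃ μ γ : ℝ, Anisotropic.ZeroOrderTerm p Ω μ γ G) ∨ ∀ x ∈ Ω, ∀ s, G x s = 0)
    (F : StrongDual ℝ (Anisotropic.AnisotropicW0 p Ω)) (hF : F = 0)
    (u : Anisotropic.AnisotropicW0 p Ω) (hu : Anisotropic.IsWeakSolution A B G F u) :
    ∀ᵐ x ∂volume.restrict (Ω : Set (Fin N → ℝ)), Anisotropic.w0Fun u x = 0 := by
  have hN1 : 1 < N := by omega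
  have : IsFiniteMeasure (volume.restrict (Ω : Set (Fin N → ℝ))) :=
    ⟨by simpa using hΩ.measure_lt_top⟩
  obtain ⟨R, hR⟩ := exists_abs_le_of_isBounded hΩ
  have hGu : Integrable (fun x => G x (w0Fun u x)) (volume.restrict (Ω : Set (Fin N → ℝ))) ∧
      ∀ᵐ x ∂volume.restrict (Ω : Set (Fin N → ℝ)), 0 ≤ G x (w0Fun u x) * w0Fun u x := by
    rcases hG with ⟨μ, γ, hG⟩ | hG
    · refine ⟨integrable_zeroOrder hN1 hpN hR hG u, ?_⟩
      filter_upwards [hG.sign] with x hx using hx _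
    · have h0 : ∀ᵐ x ∂volume.restrict (Ω : Set (Fin N → ℝ)), G x (w0Fun u x) = 0 := by
        filter_upwards [ae_restrict_mem Ω.isOpen.measurableSet] with x hx using hG x hx _
      refine ⟨(integrable_zero _ _ _).congr (h0.mono fun x hx => hx.symm), ?_⟩
      filter_upwards [h0] with x hx
      rw [hx, zero_mul]
  obtain ⟨K, hK0, hK⟩ := exists_layerEnergy_le hN1 hpN hA hB u hGu.1 hGu.2 fun ψ => by
    rw [hu ψ, hF]
    rfl
  -- The energy bound holds in all directions; only one with p_j ≤ P is exploited.
  obtain ⟨j, hj⟩ := exists_le_harmonicMean (by omega : 0 < N) p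
  have hbint := fun i =>
    (integrable_rpow_conj_and_mul hN1 hpN (hB.nonneg i) i (hB.marcinkiewicz i) u).1
  refine ae_eq_zero_of_layerEnergy_le hR u j hj (fun k => ?_) ?_
    fun k => hK ((1 / 2) ^ k) (by positivity) j
  · refine Finset.sum_nonneg fun i _ => mul_nonneg (hK0 i) (integral_nonneg_of_ae ?_)
    refine ae_restrict_of_ae ?_
    filter_upwards [ae_restrict_mem Ω.isOpen.measurableSet] with x hx
    exact Real.rpow_nonneg (hB.nonneg i x hx) _
  · have hlim : Tendsto (fun k : ℕ => ((1 / 2 : ℝ)) ^ k) atTop (𝓝 0) :=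
      tendsto_pow_atTop_nhds_zero_of_lt_one (by norm_num) (by norm_num)
    have := tendsto_finsetSum Finset.univ fun i (_ : i ∈ Finset.univ) =>
      (tendsto_setIntegral_layer u (hbint i) (fun k : ℕ => by positivity) hlim).const_mul (K i)
    simpa using this
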